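/- All graphs are finite, undirected and loopless, and may have multiple edges; $G[S]$ denotes the subgraph of $G$ induced by $S\subseteq V(G)$. The diameter of a graph is the maximum distance between two of its vertices, where the distance is the number of edges of a shortest path ($\infty$ if there is none). For a non-negative integer $c$ and graphs $H,G$, we write $H\le^{c}G$ and say that $H$ is a $c$-diameter contraction of $G$ if there is a surjection $\sigma:V(G)\to V(H)$ such that (i) for every $x\in V(H)$, the graph $G[\sigma^{-1}(x)]$ is non-empty and has diameter at most $c$, and (ii) for all distinct $x,y\in V(H)$, $x$ and $y$ are adjacent in $H$ if and only if $G[\sigma^{-1}(x)\cup\sigma^{-1}(y)]$ is connected. We write $H\le G$ and say that $H$ is a contraction of $G$ if $H\le^{c}G$ for some non-negative integer $c$. For a positive integer $k$, the uniformly triangulated grid $\Gamma_k$ is the simple graph with vertex set $\{0,\dots,k-1\}^2$ whose edges are: all pairs $\{(i,j),(i',j')\}$ with $|i-i'|+|j-j'|=1$; all pairs $\{(i+1,j),(i,j+1)\}$ with $0\le i,j\le k-2$; and all pairs consisting of $(k-1,k-1)$ and another vertex $(i,j)$ with $i\in\{0,k-1\}$ or $j\in\{0,k-1\}$. **Lemma.**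 Let $G$ and $H$ be graphs and let $c,k$ be non-negative integers such that $H\le^{c}G$ and $\Gamma_k\le G$. Put $k'=\left\lfloor\frac{k-1}{2c+1}\right\rfloor-1$ and suppose that $k'\ge 1$. Then $\Gamma_{k'}\le H$. -/

import Mathlib

/-- `H ≤_σ^c G` for multigraphs `H`, `G` and a map `σ : V(G) → V(H)`: the map is surjective, every
fibre induces a non-empty subgraph of `G` of diameter at most `c`, and two distinct vertices of `H`
are adjacent exactly when the union of their fibres induces a connected subgraph of `G`.

The extended diameter `ediam` is measured in the induced subgraph, distance being the number of
edges of a shortest path (`⊤` if there is none), so `ediam ≤ c` contains connectedness. Diameter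
and connectedness do not see edge multiplicities, so they are taken in the underlying simple
graph. -/
def IsDiamContractionVia {α β α' β' : Type*} (c : ℕ) (H : Graph α' β') (G : Graph α β)
    (σ : G.vertexSet → H.vertexSet) : Prop :=
  Function.Surjective σ ∧
  (∀ x : H.vertexSet, (σ ⁻¹' {x}).Nonempty ∧
    (G.toSimpleGraph.induce (σ ⁻¹' {x})).ediam ≤ (c : ℕ∞)) ∧
  ∀ x y : H.vertexSet, x ≠ y →
    (H.Adj x y ↔ (G.toSimpleGraph.induce (σ ⁻¹' {x} ∪ σ ⁻¹' {y})).Connected)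

/-- `H ≤^c G`: the graph `H` is a `c`-diameter contraction of `G`. -/
def IsDiamContraction {α β α' β' : Type*} (c : ℕ) (H : Graph α' β') (G : Graph α β) : Prop :=
  ∃ σ : G.vertexSet → H.vertexSet, IsDiamContractionVia c H G σ

/-- `H ≤ G`: the graph `H` is a contraction of `G`. -/
def IsContraction {α β α' β' : Type*} (H : Graph α' β') (G : Graph α β) : Prop :=
  ∃ c : ℕ, IsDiamContraction c H G

/-- The underlying simple graph of the uniformly triangulated `k × k` grid, with vertex set
`{0, …, k-1}²`: the grid edges, the diagonals `{(i+1, j), (i, j+1)}`, and all edges between the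
corner `(k-1, k-1)` and the other boundary vertices of the grid.
(`SimpleGraph.fromRel` symmetrizes the relation and discards loops.) -/
def triangulatedGridSimple (k : ℕ) : SimpleGraph (Fin k × Fin k) :=
  SimpleGraph.fromRel fun p q =>
    |(p.1.val : ℤ) - (q.1.val : ℤ)| + |(p.2.val : ℤ) - (q.2.val : ℤ)| = 1 ∨
    (p.1.val = q.1.val + 1 ∧ q.2.val = p.2.val + 1) ∨
    ((p.1.val + 1 = k ∧ p.2.val + 1 = k) ∧
      (q.1.val = 0 ∨ q.1.val + 1 = k ∨ q.2.val = 0 ∨ q.2.val + 1 = k))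

/-- The uniformly triangulated grid `Γ_k`. -/
def triangulatedGrid (k : ℕ) : Graph (Fin k × Fin k) (Sym2 (Fin k × Fin k)) :=
  Graph.ofSimpleGraph (triangulatedGridSimple k)

/-! Compose the two contractions. For a vertex `h` of `H`, let its trace be the image in `Γ_k` of
its fibre in `G`. Traces cover the grid, walks of the grid lift to walks of `H`, and adjacent
vertices have traces that meet or are joined by an edge. A trace is spanned by chains of at most `c`
steps, so it has lattice diameter at most `c` unless it meets the outside of the open square of side
`(2c+1)(k'+1)`, where the long edges of the corner of `Γ_k` are available
(`isGridTrace_of_contractionMaps`, `IsGridTrace.near`).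

Inside that square a coarse triangular lattice of mesh `2c+1` is drawn. Its inner centres stand for
the vertices of `Γ_{k'}`, and everything outside stands for the corner. The coarse edges are
oriented so that every coarse triangle is a directed cycle, and each centre owns as arms only the
last `c+1` points of the edges ending at it. Arms of distinct centres are then more than `c` apart
(`InArm.eq_of_near`), so a vertex of `H` traced on an arm or outside has a forced label: these are
the seeds.

The other labels are spread from the seeds through connected pieces, which keeps the label classes
connected: along the coarse edges (`exists_skeletal_labelling`), then over the rest
(`exists_labelling`). The invariant is that a trace inside the square lies in the open hexagon of
radius `2c+1` around a centre carrying its label. It holds because a non-seed traced on a coarse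
edge stays in the rhombus around it, hence in the hexagons of both ends, while a trace avoiding the
coarse edges cannot leave a hexagon it enters.

Adjacent vertices of `H` thus have centres at distance at most `2c+1+2c < 2(2c+1)`, so equal or
adjacent labels. Conversely, a coarse edge meets only vertices labelled by its ends, so lifting it
connects the two classes. -/

/-! ### Geometry of the coarse triangular lattice. -/

/-- Adjacency in the triangular lattice on `ℤ × ℤ`. -/
def HexAdj (p q : ℤ × ℤ) : Prop :=
  (q.1 = p.1 + 1 ∧ q.2 = p.2) ∨ (q.1 = p.1 - 1 ∧ q.2 = p.2) ∨
  (q.1 = p.1 ∧ q.2 = p.2 + 1) ∨ (q.1 = p.1 ∧ q.2 = p.2 - 1) ∨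
  (q.1 = p.1 + 1 ∧ q.2 = p.2 - 1) ∨ (q.1 = p.1 - 1 ∧ q.2 = p.2 + 1)

/-- The points `p` and `q` have distance at most `n` in the triangular lattice. -/
def HexNear (n : ℤ) (p q : ℤ × ℤ) : Prop :=
  (-n ≤ q.1 - p.1 ∧ q.1 - p.1 ≤ n) ∧ (-n ≤ q.2 - p.2 ∧ q.2 - p.2 ≤ n) ∧
  (-n ≤ (q.1 - p.1) + (q.2 - p.2) ∧ (q.1 - p.1) + (q.2 - p.2) ≤ n)

lemma HexNear.symm {n : ℤ} {p q : ℤ × ℤ} (h : HexNear n p q) : HexNear n q p := by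
  unfold HexNear at *; omega

lemma HexNear.trans {a b : ℤ} {p q r : ℤ × ℤ} (h : HexNear a p q) (h' : HexNear b q r) :
    HexNear (a + b) p r := by
  unfold HexNear at *; omega

lemma HexNear.mono {a b : ℤ} {p q : ℤ × ℤ} (h : HexNear a p q) (hab : a ≤ b) :
    HexNear b p q := by
  unfold HexNear at *; omega

lemma HexNear.refl {a : ℤ} (ha : 0 ≤ a) (p : ℤ × ℤ) : HexNear a p p := by
  unfold HexNear; omega

lemma HexAdj.near {p q : ℤ × ℤ} (h : HexAdj p q) : HexNear 1 p q := by
  unfold HexAdj at h; unfold HexNear; omega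

lemma HexAdj.symm {p q : ℤ × ℤ} (h : HexAdj p q) : HexAdj q p := by
  unfold HexAdj at *; omega

/-- The three directions, at mutual angle 120 degrees, in which lattice edges are oriented. -/
def OutDir (d : ℤ × ℤ) : Prop := d = (1, 0) ∨ d = (-1, 1) ∨ d = (0, -1)

/-- The point with index `y` of the sublattice of index `2c+1`. -/
def center (c : ℕ) (y : ℤ × ℤ) : ℤ × ℤ := ((2 * c + 1) * y.1, (2 * c + 1) * y.2)

/-- `p` is the point at parameter `t` on the ray from the centre `y` in direction `d`. -/
def AtParam (c : ℕ) (y d : ℤ × ℤ) (t : ℤ) (p : ℤ × ℤ) : Prop :=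
  p.1 = (2 * c + 1) * y.1 + t * d.1 ∧ p.2 = (2 * c + 1) * y.2 + t * d.2

/-- `p` lies on the coarse edge from the centre `y` to the centre `y + d`. -/
def OnEdge (c : ℕ) (y d p : ℤ × ℤ) : Prop := ∃ t : ℤ, 0 ≤ t ∧ t ≤ 2 * c + 1 ∧ AtParam c y d t p

/-- `p` lies on the last half of a coarse edge directed towards the centre `y`. -/
def InArm (c : ℕ) (y p : ℤ × ℤ) : Prop :=
  ∃ d, OutDir d ∧ ∃ t : ℤ, 0 ≤ t ∧ t ≤ c ∧ AtParam c y d (-t) p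

/-- `p` lies in the open hexagon of radius `2c+1` around the centre `y`. -/
def InStar (c : ℕ) (y p : ℤ × ℤ) : Prop := HexNear (2 * c) (center c y) p

/-- Makes multiples of the mesh accessible to linear arithmetic: once the products are generalized
to atoms, `omega` only needs these comparisons. -/
lemma mul_gap {m : ℤ} (hm : 0 < m) (a b : ℤ) :
    (a = b ∧ m * a = m * b) ∨ (a + 1 = b ∧ m * a + m = m * b) ∨ (b + 1 = a ∧ m * b + m = m * a) ∨
      (a + 2 ≤ b ∧ m * a + 2 * m ≤ m * b) ∨ (b + 2 ≤ a ∧ m * b + 2 * m ≤ m * a) := by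
  rcases lt_trichotomy a b with h | h | h
  · rcases eq_or_lt_of_le (Int.add_one_le_of_lt h) with h' | h'
    · right; left; subst h'; exact ⟨rfl, by ring⟩
    · right; right; right; left; exact ⟨by omega, by nlinarith⟩
  · left; subst h; exact ⟨rfl, rfl⟩
  · rcases eq_or_lt_of_le (Int.add_one_le_of_lt h) with h' | h'
    · right; right; left; subst h'; exact ⟨rfl, by ring⟩
    · right; right; right; right; exact ⟨by omega, by nlinarith⟩

/-- Distances between centres are multiples of `2c+1`, and `4c+1` is just below the second one. -/
lemma center_gap (c : ℕ) (y z : ℤ × ℤ) (h : HexNear (4 * c + 1) (center c y) (center c z)) :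
    y = z ∨ HexAdj y z := by
  have h1 := mul_gap (m := 2 * c + 1) (by omega) y.1 z.1
  have h2 := mul_gap (m := 2 * c + 1) (by omega) y.2 z.2
  -- The sum of the coordinates is the third coordinate of the hexagonal norm and needs its own gap.
  have h3 := mul_gap (m := 2 * c + 1) (by omega) (y.1 + y.2) (z.1 + z.2)
  rw [mul_add, mul_add] at h3
  unfold HexNear center at h
  simp only at h
  unfold HexAdj
  rw [Prod.ext_iff]
  generalize (2 * (c : ℤ) + 1) * y.1 = A at *
  generalize (2 * (c : ℤ) + 1) * y.2 = B at *
  generalize (2 * (c : ℤ) + 1) * z.1 = A' at *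
  generalize (2 * (c : ℤ) + 1) * z.2 = B' at *
  omega

lemma center_eq_of_near (c : ℕ) (y z : ℤ × ℤ) (h : HexNear (2 * c) (center c y) (center c z)) :
    y = z := by
  have h1 := mul_gap (m := 2 * c + 1) (by omega) y.1 z.1
  have h2 := mul_gap (m := 2 * c + 1) (by omega) y.2 z.2
  unfold HexNear center at h
  simp only at h
  rw [Prod.ext_iff]
  generalize (2 * (c : ℤ) + 1) * y.1 = A at *
  generalize (2 * (c : ℤ) + 1) * y.2 = B at *
  generalize (2 * (c : ℤ) + 1) * z.1 = A' at *
  generalize (2 * (c : ℤ) + 1) * z.2 = B' at *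
  omega

lemma InArm.near {c : ℕ} {y p : ℤ × ℤ} (h : InArm c y p) : HexNear c (center c y) p := by
  obtain ⟨d, hd, t, h0, h1, h2, h3⟩ := h
  unfold HexNear center
  simp only
  rcases hd with rfl | rfl | rfl <;> simp only at h2 h3 <;> omega

lemma inArm_center (c : ℕ) (y : ℤ × ℤ) : InArm c y (center c y) :=
  ⟨(1, 0), Or.inl rfl, 0, le_rfl, by omega, by simp [AtParam, center]⟩

/-- This is what the orientation is for. Coarse triangles are directed cycles and the points at
parameters `1, …, c` of each edge belong to no arm, which leaves a gap of `c+1`. With half-edges in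
all six directions the arms of neighbouring centres would nearly touch. -/
lemma InArm.eq_of_near {c : ℕ} {y z p q : ℤ × ℤ} (hp : InArm c y p) (hq : InArm c z q)
    (h : HexNear c p q) : y = z := by
  have hyz : y = z ∨ HexAdj y z := by
    refine center_gap c y z (((hp.near.trans h).trans hq.near.symm).mono (by omega))
  rcases hyz with hyz | hyz
  · exact hyz
  exfalso
  obtain ⟨d, hd, t, h0, h1, h2, h3⟩ := hp
  obtain ⟨e, he, s, h4, h5, h6, h7⟩ := hq
  unfold HexNear at h
  obtain ⟨y1, y2⟩ := y
  obtain ⟨z1, z2⟩ := z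
  simp only [HexAdj] at hyz h2 h3 h6 h7
  have key : ∀ a b : ℤ, (2 * (c : ℤ) + 1) * (a + b) = (2 * c + 1) * a + (2 * c + 1) * b :=
    fun a b => by ring
  have key' : ∀ a b : ℤ, (2 * (c : ℤ) + 1) * (a - b) = (2 * c + 1) * a - (2 * c + 1) * b :=
    fun a b => by ring
  rcases hyz with ⟨e1, e2⟩ | ⟨e1, e2⟩ | ⟨e1, e2⟩ | ⟨e1, e2⟩ | ⟨e1, e2⟩ | ⟨e1, e2⟩ <;>
  simp only [e1, e2, key, key', mul_one] at h6 h7 <;>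
  generalize (2 * (c : ℤ) + 1) * y1 = A at * <;>
  generalize (2 * (c : ℤ) + 1) * y2 = B at * <;>
  rcases hd with rfl | rfl | rfl <;> rcases he with rfl | rfl | rfl <;>
  simp only at h2 h3 h6 h7 <;> omega

lemma AtParam.near {c : ℕ} {y d p : ℤ × ℤ} {t n : ℤ} (hd : OutDir d) (h : AtParam c y d t p)
    (h0 : -n ≤ t) (h1 : t ≤ n) : HexNear n (center c y) p := by
  obtain ⟨h2, h3⟩ := h
  unfold HexNear center
  simp only
  rcases hd with rfl | rfl | rfl <;> simp only at h2 h3 <;> omega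

lemma AtParam.head {c : ℕ} {y d p : ℤ × ℤ} {t : ℤ} (h : AtParam c y d t p) :
    AtParam c (y + d) d (-(2 * c + 1 - t)) p := by
  obtain ⟨h2, h3⟩ := h
  constructor
  · rw [h2, Prod.fst_add]; ring
  · rw [h3, Prod.snd_add]; ring

lemma OnEdge.cases {c : ℕ} {y d p : ℤ × ℤ} (hd : OutDir d) (h : OnEdge c y d p) :
    InArm c y p ∨ InArm c (y + d) p ∨ ∃ t : ℤ, 1 ≤ t ∧ t ≤ c ∧ AtParam c y d t p := by
  obtain ⟨t, h0, h1, h2⟩ := h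
  rcases eq_or_lt_of_le h0 with rfl | h0
  -- Parameter `0` is the centre `y` itself, which lies on all arms of `y`.
  · left; exact ⟨d, hd, 0, le_rfl, by omega, by simpa using h2⟩
  by_cases ht : t ≤ c
  · right; right; exact ⟨t, by omega, ht, h2⟩
  · right; left; exact ⟨d, hd, 2 * c + 1 - t, by omega, by omega, h2.head⟩

/-- In a coarse triangle every point of an edge is at lattice distance exactly `2c+1` from the
opposite corner, hence outside its open hexagon; other centres are no closer. -/
lemma InStar.eq_or_eq {c : ℕ} {y d z p : ℤ × ℤ} (hd : OutDir d) (h : OnEdge c y d p)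
    (hz : InStar c z p) : z = y ∨ z = y + d := by
  obtain ⟨t, h0, h1, h2⟩ := h
  by_cases ht0 : t = 0
  · left
    refine center_eq_of_near c z y ?_
    subst ht0
    have := h2.near (n := 0) hd (by omega) (by omega)
    simpa using HexNear.trans hz this.symm
  by_cases ht1 : t = 2 * c + 1
  · right
    refine center_eq_of_near c z _ ?_
    have := h2.head.near (n := 0) hd (by omega) (by omega)
    simpa using HexNear.trans hz this.symm
  have hyz : z = y ∨ HexAdj z y := center_gap c z y
    ((hz.trans (h2.near (n := 2 * c) hd (by omega) (by omega)).symm).mono (by omega))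
  rcases hyz with hyz | hyz
  · exact .inl hyz
  right
  obtain ⟨y1, y2⟩ := y
  obtain ⟨z1, z2⟩ := z
  obtain ⟨h3, h4⟩ := h2
  simp only [HexAdj] at hyz h3 h4
  unfold InStar HexNear center at hz
  simp only at hz
  have key : ∀ a b : ℤ, (2 * (c : ℤ) + 1) * (a + b) = (2 * c + 1) * a + (2 * c + 1) * b :=
    fun a b => by ring
  have key' : ∀ a b : ℤ, (2 * (c : ℤ) + 1) * (a - b) = (2 * c + 1) * a - (2 * c + 1) * b :=
    fun a b => by ring
  rcases hyz with ⟨e1, e2⟩ | ⟨e1, e2⟩ | ⟨e1, e2⟩ | ⟨e1, e2⟩ | ⟨e1, e2⟩ | ⟨e1, e2⟩ <;>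
  simp only [e1, e2, key, key', mul_one] at h3 h4 <;>
  generalize (2 * (c : ℤ) + 1) * z1 = A at * <;>
  generalize (2 * (c : ℤ) + 1) * z2 = B at * <;>
  rcases hd with rfl | rfl | rfl <;> simp only [e1, e2, Prod.mk_add_mk, Prod.mk.injEq] at h3 h4 ⊢ <;> omega

/-- The open rhombus around a coarse edge `y → y + d` can only be left through the arms directed
towards a centre, as long as one stays near to a point of the first half of that edge. -/
lemma rhombus_step {c : ℕ} {y d p q r : ℤ × ℤ} {t : ℤ} (hd : OutDir d) (h1 : 1 ≤ t) (h2 : t ≤ c)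
    (hp : AtParam c y d t p) (hq : InStar c y q ∧ InStar c (y + d) q) (hqr : HexAdj q r)
    (hpr : HexNear c p r) (hr : ¬ ∃ z, InArm c z r) : InStar c y r ∧ InStar c (y + d) r := by
  have hy : InStar c y r := ((hp.near (n := c) hd (by omega) h2).trans hpr).mono (by omega)
  refine ⟨hy, ?_⟩
  by_contra hcon
  obtain ⟨hq1, hq2⟩ := hq
  have harm : ∀ e, OutDir e → ∀ s : ℤ, 0 ≤ s → s ≤ c → ¬ AtParam c y e (-s) r :=
    fun e he s hs hs' hh => hr ⟨y, e, he, s, hs, hs', hh⟩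
  -- The third argument is the parameter `r` would have on each of the three arms of `y`. Leaving
  -- the rhombus means crossing an edge into `y` or an edge out of `y + d`; the latter is more than
  -- `c` away from `p`, and the former is reached only within distance `c` of `y`, that is, on an
  -- arm.
  have ha := harm _ (.inl rfl) ((2 * c + 1) * y.1 - r.1)
  have hb := harm _ (.inr (.inl rfl)) (r.1 - (2 * c + 1) * y.1)
  have hc := harm _ (.inr (.inr rfl)) (r.2 - (2 * c + 1) * y.2)
  obtain ⟨y1, y2⟩ := y
  obtain ⟨h3, h4⟩ := hp
  unfold InStar HexNear center at *
  unfold AtParam at ha hb hc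
  unfold HexAdj at hqr
  have key : ∀ a b : ℤ, (2 * (c : ℤ) + 1) * (a + b) = (2 * c + 1) * a + (2 * c + 1) * b :=
    fun a b => by ring
  simp only [Prod.fst_add, Prod.snd_add, key] at *
  generalize (2 * (c : ℤ) + 1) * y1 = A at *
  generalize (2 * (c : ℤ) + 1) * y2 = B at *
  rcases hd with rfl | rfl | rfl <;> simp only at * <;> omega

/-- The coarse lines are the level sets, at multiples of `2c+1`, of the three hexagonal coordinates.
-/
lemma exists_onEdge {c : ℕ} {p : ℤ × ℤ} (h : (2 * (c : ℤ) + 1) ∣ p.1 ∨ (2 * (c : ℤ) + 1) ∣ p.2 ∨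
    (2 * (c : ℤ) + 1) ∣ p.1 + p.2) : ∃ y d, OutDir d ∧ OnEdge c y d p := by
  obtain ⟨a, b⟩ := p
  simp only at h
  have hm : (0 : ℤ) < 2 * c + 1 := by omega
  rcases h with ⟨i, rfl⟩ | ⟨j, rfl⟩ | ⟨n, hn⟩
  · have e := Int.mul_ediv_add_emod b (2 * c + 1)
    have e1 := Int.emod_nonneg b hm.ne'
    have e2 := Int.emod_lt_of_pos b hm
    -- The direction `(0, -1)` decreases the coordinate, so the tail is the upper end and the
    -- parameter is counted down from it.
    refine ⟨(i, b / (2 * c + 1) + 1), (0, -1), .inr (.inr rfl), 2 * c + 1 - b % (2 * c + 1),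
      by omega, by omega, by simp, ?_⟩
    simp only
    linear_combination -e
  · have e := Int.mul_ediv_add_emod a (2 * c + 1)
    have e1 := Int.emod_nonneg a hm.ne'
    have e2 := Int.emod_lt_of_pos a hm
    refine ⟨(a / (2 * c + 1), j), (1, 0), .inl rfl, a % (2 * c + 1),
      by omega, by omega, ?_, by simp⟩
    simp only
    linear_combination -e
  · have e := Int.mul_ediv_add_emod a (2 * c + 1)
    have e1 := Int.emod_nonneg a hm.ne'
    have e2 := Int.emod_lt_of_pos a hm
    refine ⟨(a / (2 * c + 1) + 1, n - a / (2 * c + 1) - 1), (-1, 1), .inr (.inl rfl),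
      2 * c + 1 - a % (2 * c + 1), by omega, by omega, ?_, ?_⟩
    · simp only
      linear_combination -e
    · simp only
      linear_combination hn + e

/-- Away from all coarse edges, one cannot leave an open hexagon. -/
lemma InStar.step {c : ℕ} {y p q : ℤ × ℤ} (hq : InStar c y q) (h : HexAdj q p)
    (hp : ¬ ∃ y d, OutDir d ∧ OnEdge c y d p) : InStar c y p := by
  by_contra hcon
  refine hp (exists_onEdge ?_)
  have key : p.1 = (2 * c + 1) * y.1 + (2 * c + 1) ∨ p.1 = (2 * c + 1) * y.1 - (2 * c + 1) ∨
      p.2 = (2 * c + 1) * y.2 + (2 * c + 1) ∨ p.2 = (2 * c + 1) * y.2 - (2 * c + 1) ∨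
      p.1 + p.2 = (2 * c + 1) * y.1 + (2 * c + 1) * y.2 + (2 * c + 1) ∨
      p.1 + p.2 = (2 * c + 1) * y.1 + (2 * c + 1) * y.2 - (2 * c + 1) := by
    unfold InStar HexNear center at *
    unfold HexAdj at h
    simp only at *
    generalize (2 * (c : ℤ) + 1) * y.1 = A at *
    generalize (2 * (c : ℤ) + 1) * y.2 = B at *
    omega
  rcases key with h | h | h | h | h | h
  · exact .inl ⟨y.1 + 1, by rw [h]; ring⟩
  · exact .inl ⟨y.1 - 1, by rw [h]; ring⟩
  · exact .inr (.inl ⟨y.2 + 1, by rw [h]; ring⟩)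
  · exact .inr (.inl ⟨y.2 - 1, by rw [h]; ring⟩)
  · exact .inr (.inr ⟨y.1 + y.2 + 1, by rw [h]; ring⟩)
  · exact .inr (.inr ⟨y.1 + y.2 - 1, by rw [h]; ring⟩)

/-- No direction is the negative of another, so a coarse edge is determined by its unordered pair of
ends. -/
lemma OutDir.edge_eq {y z d e : ℤ × ℤ} (hd : OutDir d) (he : OutDir e)
    (h1 : y = z ∨ y = z + e) (h2 : y + d = z ∨ y + d = z + e) : y = z ∧ d = e := by
  obtain ⟨y1, y2⟩ := y
  obtain ⟨z1, z2⟩ := z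
  rcases hd with rfl | rfl | rfl <;> rcases he with rfl | rfl | rfl <;>
  simp only [Prod.mk_add_mk, Prod.mk.injEq, and_true] at h1 h2 ⊢ <;> omega

/-! ### Walks inside a set and extension of labellings. -/

/-- The vertices `u` and `v` are joined by a walk of `G` all of whose vertices lie in `S`
(or `u = v`). -/
def SimpleGraph.JoinedWithin {V : Type*} (G : SimpleGraph V) (S : Set V) : V → V → Prop :=
  Relation.ReflTransGen fun a b => G.Adj a b ∧ a ∈ S ∧ b ∈ S

namespace SimpleGraph.JoinedWithin

variable {V W : Type*} {G : SimpleGraph V} {K : SimpleGraph W} {S S' : Set V} {u v w : V}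

lemma symm (h : G.JoinedWithin S u v) : G.JoinedWithin S v u := by
  induction h with
  | refl => exact Relation.ReflTransGen.refl
  | tail _ h ih => exact Relation.ReflTransGen.head ⟨h.1.symm, h.2.2, h.2.1⟩ ih

lemma trans (h : G.JoinedWithin S u v) (h' : G.JoinedWithin S v w) : G.JoinedWithin S u w :=
  Relation.ReflTransGen.trans h h'

lemma mono (hS : S ⊆ S') (h : G.JoinedWithin S u v) : G.JoinedWithin S' u v :=
  Relation.ReflTransGen.mono (fun _ _ ⟨h1, h2, h3⟩ => ⟨h1, hS h2, hS h3⟩) _ _ h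

lemma of_adj (h : G.Adj u v) (hu : u ∈ S) (hv : v ∈ S) : G.JoinedWithin S u v :=
  Relation.ReflTransGen.single ⟨h, hu, hv⟩

/-- An invariant preserved by the edges inside `S` is preserved along walks inside `S`. -/
lemma invariant {P : V → Prop} (h : G.JoinedWithin S u v) (hu : P u)
    (hP : ∀ a b, P a → G.Adj a b → a ∈ S → b ∈ S → P b) : P v := by
  induction h with
  | refl => exact hu
  | tail _ h ih => exact hP _ _ ih h.1 h.2.1 h.2.2

lemma image {f : V → W} (hf : ∀ a b, G.Adj a b → f a = f b ∨ K.Adj (f a) (f b))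
    (h : G.JoinedWithin S u v) : K.JoinedWithin (f '' S) (f u) (f v) := by
  induction h with
  | refl => exact Relation.ReflTransGen.refl
  | tail _ h ih =>
    refine ih.trans ?_
    rcases hf _ _ h.1 with e | e
    · rw [e]; exact Relation.ReflTransGen.refl
    · exact of_adj e ⟨_, h.2.1, rfl⟩ ⟨_, h.2.2, rfl⟩

end SimpleGraph.JoinedWithin

lemma SimpleGraph.induce_preconnected_iff_joinedWithin {V : Type*} {G : SimpleGraph V}
    {S : Set V} :
    (G.induce S).Preconnected ↔ ∀ u ∈ S, ∀ v ∈ S, G.JoinedWithin S u v := by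
  constructor
  · intro h u hu v hv
    have := SimpleGraph.reachable_iff_reflTransGen _ _ |>.1 (h ⟨u, hu⟩ ⟨v, hv⟩)
    exact Relation.ReflTransGen.lift (Subtype.val : S → V)
      (fun a b hab => ⟨hab, a.2, b.2⟩) _ _ this
  · rintro h ⟨u, hu⟩ ⟨v, hv⟩
    have hj : ∀ w, G.JoinedWithin S u w → ∀ hw : w ∈ S,
        (G.induce S).Reachable ⟨u, hu⟩ ⟨w, hw⟩ := by
      intro w hw
      induction hw with
      | refl => intro _; exact Reachable.refl _
      | tail _ h ih =>
        intro hw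
        refine (ih h.2.1).trans (Adj.reachable ?_)
        exact h.1
    exact hj v (h u hu v hv) hv

/-- A labelling of `S` extends along links: every vertex outside `S` from which `S` can be reached
by links gets the label of a vertex of `S`, and the walk reaching it has constant label. -/
lemma exists_extension {V X : Type*} (G : SimpleGraph V) (S : Set V) (τ : V → X)
    (N : V → V → Prop) (hN : ∀ a b, N a b → N b a) (hNG : ∀ a b, N a b → G.Adj a b) :
    ∃ τ' : V → X, (∀ v ∈ S, τ' v = τ v) ∧
      ∀ v ∉ S, (∃ g ∈ S, Relation.ReflTransGen (fun a b => a ∉ S ∧ N a b) v g) →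
        ∃ g ∈ S, Relation.ReflTransGen (fun a b => a ∉ S ∧ N a b) v g ∧ τ' v = τ g ∧
          G.JoinedWithin {w | τ' w = τ' v ∧ (w ∈ S ∨ ∃ x, N w x)} v g := by
  classical
  let R : V → V → Prop := fun a b => a ∉ S ∧ N a b
  let C : V → Set V := fun v => {g | g ∈ S ∧ Relation.ReflTransGen R v g}
  have hC : ∀ a b, R a b → b ∉ S → C a = C b := by
    intro a b hab hb
    ext g
    constructor
    · rintro ⟨hg, h⟩
      exact ⟨hg, (Relation.ReflTransGen.single ⟨hb, hN _ _ hab.2⟩).trans h⟩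
    · rintro ⟨hg, h⟩
      exact ⟨hg, (Relation.ReflTransGen.single hab).trans h⟩
  -- Where the set is non-empty the choice depends on it alone, so vertices outside `S` in the same
  -- linked component get the same label; `v` is only a default.
  let pick : V → Set V → V := fun v A => if h : A.Nonempty then h.some else v
  let τ' : V → X := fun v => if v ∈ S then τ v else τ (pick v (C v))
  have hτS : ∀ v ∈ S, τ' v = τ v := fun v hv => if_pos hv
  refine ⟨τ', hτS, ?_⟩
  rintro v hv ⟨g₀, hg₀, hvg₀⟩
  have hne : (C v).Nonempty := ⟨g₀, hg₀, hvg₀⟩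
  have hval : ∀ w, w ∉ S → C w = C v → τ' w = τ hne.some := by
    intro w hw hwC
    simp only [τ', if_neg hw, pick, hwC, dif_pos hne]
  have hg := hne.some_mem
  generalize hne.some = g at *
  refine ⟨g, hg.1, hg.2, hval v hv rfl, ?_⟩
  rw [hval v hv rfl]
  have key : ∀ w, Relation.ReflTransGen R w g → w ∉ S → C w = C v →
      G.JoinedWithin {x | τ' x = τ g ∧ (x ∈ S ∨ ∃ z, N x z)} w g := by
    intro w hw
    induction hw using Relation.ReflTransGen.head_induction_on with
    | refl => intro h; exact absurd hg.1 h
    | @head a b hab hbc ih =>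
      intro ha hCa
      by_cases hb : b ∈ S
      · have hbg : b = g := by
          rcases hbc.cases_head with h | ⟨x, hx, _⟩
          · exact h
          · exact absurd hb hx.1
        subst hbg
        exact SimpleGraph.JoinedWithin.of_adj (hNG _ _ hab.2)
          ⟨hval a ha hCa, .inr ⟨_, hab.2⟩⟩ ⟨hτS _ hb, .inl hb⟩
      · have hCb : C b = C v := (hC a b hab hb).symm.trans hCa
        refine SimpleGraph.JoinedWithin.trans (.of_adj (hNG _ _ hab.2) ?_ ?_) (ih hb hCb)
        · exact ⟨hval a ha hCa, .inr ⟨_, hab.2⟩⟩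
        · exact ⟨hval b hb hCb, .inr ⟨_, hN _ _ hab.2⟩⟩
  exact key v hg.2 hv rfl

/-- A walk inside `A` from `u ∉ S` to a vertex of `S`, cut at its first vertex in `S`. -/
lemma SimpleGraph.JoinedWithin.exists_first {V : Type*} {G : SimpleGraph V} {A S : Set V} {u v : V}
    (h : G.JoinedWithin A u v) (hv : v ∈ S) :
    ∃ g ∈ S, Relation.ReflTransGen (fun a b => a ∉ S ∧ G.Adj a b ∧ a ∈ A ∧ b ∈ A) u g := by
  induction h using Relation.ReflTransGen.head_induction_on with
  | refl => exact ⟨v, hv, Relation.ReflTransGen.refl⟩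
  | @head a b hab _ ih =>
    by_cases ha : a ∈ S
    · exact ⟨a, ha, Relation.ReflTransGen.refl⟩
    · obtain ⟨g, hg, hbg⟩ := ih
      exact ⟨g, hg, Relation.ReflTransGen.head ⟨ha, hab⟩ hbg⟩

/-! ### Contraction maps of simple graphs. -/

/-- `φ` contracts the simple graph `G` onto the simple graph `K`. -/
structure IsContractionMap {V W : Type*} (K : SimpleGraph W) (G : SimpleGraph V) (φ : V → W) :
    Prop where
  surjective : Function.Surjective φ
  fiber : ∀ u v, φ u = φ v → G.JoinedWithin (φ ⁻¹' {φ u}) u v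
  adj_iff : ∀ x y, x ≠ y → (K.Adj x y ↔
    ∀ u ∈ φ ⁻¹' {x} ∪ φ ⁻¹' {y}, ∀ v ∈ φ ⁻¹' {x} ∪ φ ⁻¹' {y},
      G.JoinedWithin (φ ⁻¹' {x} ∪ φ ⁻¹' {y}) u v)

namespace IsContractionMap

variable {V W : Type*} {K : SimpleGraph W} {G : SimpleGraph V} {φ : V → W}

/-- One edge between two connected fibres already connects their union. -/
lemma eq_or_adj (h : IsContractionMap K G φ) {u v : V} (huv : G.Adj u v) :
    φ u = φ v ∨ K.Adj (φ u) (φ v) := by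
  by_cases he : φ u = φ v
  · exact .inl he
  right
  rw [h.adj_iff _ _ he]
  have hu : ∀ w, w ∈ φ ⁻¹' {φ u} ∪ φ ⁻¹' {φ v} →
      G.JoinedWithin (φ ⁻¹' {φ u} ∪ φ ⁻¹' {φ v}) w u := by
    rintro w (hw | hw)
    · refine ((h.fiber w u hw).mono ?_)
      rw [show φ w = φ u from hw]; exact Set.subset_union_left
    · refine ((h.fiber w v hw).mono ?_).trans (.of_adj huv.symm (.inr rfl) (.inl rfl))
      rw [show φ w = φ v from hw]; exact Set.subset_union_right
  exact fun a ha b hb => (hu a ha).trans (hu b hb).symm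

/-- Walks lift because fibres, and unions of adjacent fibres, are connected. `hx` serves the empty
walk, for which `JoinedWithin` demands no membership. -/
lemma preimage (h : IsContractionMap K G φ) {P : Set W} {x y : W} (hxy : K.JoinedWithin P x y)
    (hx : x ∈ P) {u v : V} (hu : φ u = x) (hv : φ v = y) : G.JoinedWithin (φ ⁻¹' P) u v := by
  have fib : ∀ a b, φ a = φ b → φ a ∈ P → G.JoinedWithin (φ ⁻¹' P) a b := by
    intro a b hab ha
    refine (h.fiber a b hab).mono ?_
    rintro w (hw : φ w = φ a)
    change φ w ∈ P
    rwa [hw]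
  induction hxy generalizing v with
  | refl => exact fib u v (hu.trans hv.symm) (hu ▸ hx)
  | @tail b d _ hbc ih =>
    obtain ⟨w, hw⟩ := h.surjective b
    refine (ih hw).trans ?_
    refine ((h.adj_iff b d hbc.1.ne).1 hbc.1 w (.inl hw) v (.inr hv)).mono ?_
    rintro z (hz | hz)
    · change φ z ∈ P; rw [show φ z = b from hz]; exact hbc.2.1
    · change φ z ∈ P; rw [show φ z = d from hz]; exact hbc.2.2

end IsContractionMap

/-! ### The triangulated grid as a piece of the lattice. -/

/-- The position of a vertex of the grid in the triangular lattice. -/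
def gridCoord {k : ℕ} (p : Fin k × Fin k) : ℤ × ℤ := (p.1.val, p.2.val)

/-- `p` lies outside the open square `(0, K)²`. -/
def Outer (K : ℤ) (p : ℤ × ℤ) : Prop := p.1 ≤ 0 ∨ p.2 ≤ 0 ∨ K ≤ p.1 ∨ K ≤ p.2

lemma gridCoord_injective {k : ℕ} : Function.Injective (gridCoord (k := k)) := by
  rintro ⟨a, b⟩ ⟨a', b'⟩ h
  simp only [gridCoord, Prod.mk.injEq] at h
  ext <;> simp only <;> omega

lemma exists_gridCoord {k : ℕ} (x : ℤ × ℤ) (h1 : 0 ≤ x.1 ∧ x.1 < k) (h2 : 0 ≤ x.2 ∧ x.2 < k) :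
    ∃ p : Fin k × Fin k, gridCoord p = x := by
  refine ⟨(⟨x.1.toNat, by omega⟩, ⟨x.2.toNat, by omega⟩), ?_⟩
  ext <;> simp only [gridCoord] <;> omega

lemma triangulatedGridSimple_adj_of_hexAdj {k : ℕ} {p q : Fin k × Fin k}
    (h : HexAdj (gridCoord p) (gridCoord q)) : (triangulatedGridSimple k).Adj p q := by
  unfold triangulatedGridSimple
  rw [SimpleGraph.fromRel_adj]
  obtain ⟨⟨a, ha⟩, ⟨b, hb⟩⟩ := p
  obtain ⟨⟨a', ha'⟩, ⟨b', hb'⟩⟩ := q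
  unfold HexAdj gridCoord at h
  simp only [ne_eq, Prod.mk.injEq, Fin.mk.injEq] at h ⊢
  refine ⟨by omega, ?_⟩
  rcases h with h | h | h | h | h | h
  · left; left; rw [abs_eq_max_neg, abs_eq_max_neg]; omega
  · left; left; rw [abs_eq_max_neg, abs_eq_max_neg]; omega
  · left; left; rw [abs_eq_max_neg, abs_eq_max_neg]; omega
  · left; left; rw [abs_eq_max_neg, abs_eq_max_neg]; omega
  · right; right; left; omega
  · left; right; left; omega

/-- The long edges of the corner end on the boundary, which is outer as soon as `K ≤ k - 1`. -/
lemma hexAdj_of_triangulatedGridSimple_adj {k : ℕ} {K : ℤ} (hK : K ≤ k - 1) {p q : Fin k × Fin k}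
    (h : (triangulatedGridSimple k).Adj p q) (hp : ¬ Outer K (gridCoord p)) :
    HexAdj (gridCoord p) (gridCoord q) := by
  unfold triangulatedGridSimple at h
  rw [SimpleGraph.fromRel_adj] at h
  obtain ⟨⟨a, ha⟩, ⟨b, hb⟩⟩ := p
  obtain ⟨⟨a', ha'⟩, ⟨b', hb'⟩⟩ := q
  unfold HexAdj gridCoord
  unfold Outer gridCoord at hp
  simp only [ne_eq, Prod.mk.injEq, Fin.mk.injEq, abs_eq_max_neg] at h hp ⊢
  omega

lemma triangulatedGridSimple_corner {k : ℕ} {p q : Fin k × Fin k}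
    (hq : q.1.val + 1 = k ∧ q.2.val + 1 = k)
    (hp : p.1.val = 0 ∨ p.1.val + 1 = k ∨ p.2.val = 0 ∨ p.2.val + 1 = k) :
    p = q ∨ (triangulatedGridSimple k).Adj p q := by
  by_cases h : p = q
  · exact .inl h
  · right
    unfold triangulatedGridSimple
    rw [SimpleGraph.fromRel_adj]
    exact ⟨h, .inr (.inr (.inr ⟨hq, hp⟩))⟩

lemma segment_joined {c k : ℕ} {y d : ℤ × ℤ} (hd : OutDir d) {p : Fin k × Fin k} {s : ℤ}
    (hp : AtParam c y d s (gridCoord p)) (N : ℕ) {q : Fin k × Fin k}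
    (hq : AtParam c y d (s + N) (gridCoord q)) :
    (triangulatedGridSimple k).JoinedWithin
      {r | ∃ t : ℤ, s ≤ t ∧ t ≤ s + N ∧ AtParam c y d t (gridCoord r)} p q := by
  induction N generalizing q with
  | zero =>
    have : p = q := by
      apply gridCoord_injective
      obtain ⟨h1, h2⟩ := hp
      obtain ⟨h3, h4⟩ := hq
      ext
      · rw [h1, h3]; simp
      · rw [h2, h4]; simp
    subst this
    exact Relation.ReflTransGen.refl
  | succ N ih =>
    obtain ⟨h1, h2⟩ := hp
    obtain ⟨h3, h4⟩ := hq
    obtain ⟨r, hr⟩ : ∃ r : Fin k × Fin k, gridCoord r =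
        ((2 * c + 1) * y.1 + (s + N) * d.1, (2 * c + 1) * y.2 + (s + N) * d.2) := by
      have b1 := p.1.isLt
      have b2 := p.2.isLt
      have b3 := q.1.isLt
      have b4 := q.2.isLt
      simp only [gridCoord] at h1 h2 h3 h4
      generalize (2 * (c : ℤ) + 1) * y.1 = A at *
      generalize (2 * (c : ℤ) + 1) * y.2 = B at *
      apply exists_gridCoord <;> rcases hd with rfl | rfl | rfl <;>
        simp only [mul_one, mul_zero, mul_neg, Nat.cast_add, Nat.cast_one] at * <;> omega
    have hr' : AtParam c y d (s + N) (gridCoord r) := by rw [hr]; exact ⟨rfl, rfl⟩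
    refine ((ih hr').mono ?_).trans (.of_adj (triangulatedGridSimple_adj_of_hexAdj ?_) ?_ ?_)
    · rintro x ⟨t, ht1, ht2, ht3⟩
      exact ⟨t, ht1, by push_cast; omega, ht3⟩
    · rw [hr]
      unfold HexAdj
      simp only
      push_cast at h3 h4
      generalize (2 * (c : ℤ) + 1) * y.1 = A at *
      generalize (2 * (c : ℤ) + 1) * y.2 = B at *
      rcases hd with rfl | rfl | rfl <;>
        simp only [mul_one, mul_zero, mul_neg] at * <;> omega
    · exact ⟨s + N, by omega, by push_cast; omega, hr'⟩
    · exact ⟨s + (N + 1 : ℕ), by omega, le_rfl, h3, h4⟩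

/-- An outer point off the boundary has a coordinate at least `K`; increasing that coordinate keeps
it outer until the boundary, all of which is joined to the corner. -/
lemma outer_joined_corner {k : ℕ} {K : ℤ} (hK : K ≤ k - 1) {w p : Fin k × Fin k}
    (hw : w.1.val + 1 = k ∧ w.2.val + 1 = k) (hp : Outer K (gridCoord p)) :
    (triangulatedGridSimple k).JoinedWithin {r | Outer K (gridCoord r)} p w := by
  have hwo : Outer K (gridCoord w) := by
    unfold Outer gridCoord; simp only; omega
  have bd : ∀ p : Fin k × Fin k, Outer K (gridCoord p) →
      (p.1.val = 0 ∨ p.1.val + 1 = k ∨ p.2.val = 0 ∨ p.2.val + 1 = k) →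
      (triangulatedGridSimple k).JoinedWithin {r | Outer K (gridCoord r)} p w := by
    intro p hp hb
    rcases triangulatedGridSimple_corner hw hb with rfl | h
    · exact Relation.ReflTransGen.refl
    · exact .of_adj h hp hwo
  generalize hn : 2 * k - (p.1.val + p.2.val) = n
  induction n using Nat.strong_induction_on generalizing p with
  | _ n ih =>
    by_cases hb : p.1.val = 0 ∨ p.1.val + 1 = k ∨ p.2.val = 0 ∨ p.2.val + 1 = k
    · exact bd p hp hb
    have b1 := p.1.isLt
    have b2 := p.2.isLt
    have hp' := hp
    simp only [Outer, gridCoord] at hp'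
    by_cases h1 : K ≤ p.1.val
    · obtain ⟨r, hr⟩ := exists_gridCoord (k := k) ((p.1.val : ℤ) + 1, (p.2.val : ℤ))
        (by simp only; omega) (by simp only; omega)
      have hr' := hr
      simp only [gridCoord, Prod.mk.injEq] at hr'
      have hro : Outer K (gridCoord r) := by rw [hr]; unfold Outer; simp only; omega
      refine (SimpleGraph.JoinedWithin.of_adj (triangulatedGridSimple_adj_of_hexAdj ?_) hp
        hro).trans (ih _ ?_ hro rfl)
      · rw [hr]; exact .inl ⟨rfl, rfl⟩
      · omega
    · obtain ⟨r, hr⟩ := exists_gridCoord (k := k) ((p.1.val : ℤ), (p.2.val : ℤ) + 1)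
        (by simp only; omega) (by simp only; omega)
      have hr' := hr
      simp only [gridCoord, Prod.mk.injEq] at hr'
      have hro : Outer K (gridCoord r) := by rw [hr]; unfold Outer; simp only; omega
      refine (SimpleGraph.JoinedWithin.of_adj (triangulatedGridSimple_adj_of_hexAdj ?_) hp
        hro).trans (ih _ ?_ hro rfl)
      · rw [hr]; exact .inr (.inr (.inl ⟨rfl, rfl⟩))
      · omega

/-! ### Traces and their lattice diameter. -/

/-- The sets `T h` of grid points behave like the images in the `k × k` grid of the fibres of a
`c`-diameter contraction onto `G`, for a graph that also contracts onto the grid. -/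
structure IsGridTrace {V : Type*} (G : SimpleGraph V) (c k : ℕ) (T : V → Set (Fin k × Fin k)) :
    Prop where
  nonempty : ∀ h, (T h).Nonempty
  cover : ∀ p, ∃ h, p ∈ T h
  joined : ∀ {P p q h h'}, (triangulatedGridSimple k).JoinedWithin P p q → p ∈ P → p ∈ T h →
    q ∈ T h' → G.JoinedWithin {g | ∃ r ∈ T g, r ∈ P} h h'
  chain : ∀ {h p q}, p ∈ T h → q ∈ T h → ∃ n ≤ c, ∃ f : ℕ → Fin k × Fin k, f 0 = p ∧ f n = q ∧
    (∀ i ≤ n, f i ∈ T h) ∧ ∀ i < n, f i = f (i + 1) ∨ (triangulatedGridSimple k).Adj (f i) (f (i + 1))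
  adj : ∀ {h h'}, G.Adj h h' → ∃ p ∈ T h, ∃ q ∈ T h', p = q ∨ (triangulatedGridSimple k).Adj p q

/-- `h` is traced on a set of lattice points. -/
def Hits {V : Type*} {k : ℕ} (T : V → Set (Fin k × Fin k)) (h : V) (A : Set (ℤ × ℤ)) : Prop :=
  ∃ p ∈ T h, gridCoord p ∈ A

/-- Only steps starting at inner points are controlled, but the last point may be outer;
`near_outer` uses this at the first outer point of a chain. -/
lemma chain_near {k : ℕ} {K : ℤ} (hK : K ≤ k - 1) {f : ℕ → Fin k × Fin k} {n : ℕ}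
    (hf : ∀ i < n, f i = f (i + 1) ∨ (triangulatedGridSimple k).Adj (f i) (f (i + 1)))
    (i : ℕ) (hi : i ≤ n) (hO : ∀ j < i, ¬ Outer K (gridCoord (f j))) :
    HexNear i (gridCoord (f 0)) (gridCoord (f i)) := by
  induction i with
  | zero => exact HexNear.refl le_rfl _
  | succ i ih =>
    have h1 := ih (by omega) (fun j hj => hO j (by omega))
    rcases hf i (by omega) with h | h
    · rw [← h]; exact h1.mono (by push_cast; omega)
    · have := h1.trans (hexAdj_of_triangulatedGridSimple_adj hK h (hO i (by omega))).near
      exact_mod_cast this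

namespace IsGridTrace

variable {V : Type*} {G : SimpleGraph V} {c k : ℕ} {T : V → Set (Fin k × Fin k)} {K : ℤ}

lemma near (ht : IsGridTrace G c k T) (hK : K ≤ k - 1) {h : V} (hh : ¬ Hits T h {p | Outer K p})
    {p q : Fin k × Fin k} (hp : p ∈ T h) (hq : q ∈ T h) :
    HexNear c (gridCoord p) (gridCoord q) := by
  obtain ⟨n, hn, f, rfl, rfl, hfT, hf⟩ := ht.chain hp hq
  exact (chain_near hK hf n le_rfl (fun j hj hO => hh ⟨_, hfT j hj.le, hO⟩)).mono
    (by exact_mod_cast hn)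

lemma near_outer (ht : IsGridTrace G c k T) (hK : K ≤ k - 1) {h : V}
    (hh : Hits T h {p | Outer K p}) {p : Fin k × Fin k} (hp : p ∈ T h) :
    ∃ o, Outer K o ∧ HexNear c (gridCoord p) o := by
  classical
  obtain ⟨q, hq, hqO⟩ := hh
  obtain ⟨n, hn, f, rfl, rfl, hfT, hf⟩ := ht.chain hp hq
  have hex : ∃ i, Outer K (gridCoord (f i)) := ⟨n, hqO⟩
  have hle : Nat.find hex ≤ n := Nat.find_min' hex hqO
  refine ⟨_, Nat.find_spec hex, (chain_near hK hf (Nat.find hex) hle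
    (fun j hj => Nat.find_min hex hj)).mono ?_⟩
  exact_mod_cast hle.trans hn

lemma invariant (ht : IsGridTrace G c k T) (hK : K ≤ k - 1) {h : V}
    (hh : ¬ Hits T h {p | Outer K p}) {P : ℤ × ℤ → Prop} {p q : Fin k × Fin k} (hp : p ∈ T h)
    (hq : q ∈ T h) (hPp : P (gridCoord p))
    (hP : ∀ a ∈ T h, ∀ b ∈ T h, P (gridCoord a) → HexAdj (gridCoord a) (gridCoord b) →
      P (gridCoord b)) : P (gridCoord q) := by
  obtain ⟨n, hn, f, rfl, rfl, hfT, hf⟩ := ht.chain hp hq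
  have : ∀ i ≤ n, P (gridCoord (f i)) := by
    intro i
    induction i with
    | zero => exact fun _ => hPp
    | succ i ih =>
      intro hi
      rcases hf i (by omega) with h | h
      · rw [← h]; exact ih (by omega)
      · exact hP _ (hfT i (by omega)) _ (hfT _ hi) (ih (by omega))
          (hexAdj_of_triangulatedGridSimple_adj hK h (fun hO => hh ⟨_, hfT i (by omega), hO⟩))
  exact this n le_rfl

lemma hexAdj_of_adj (ht : IsGridTrace G c k T) (hK : K ≤ k - 1) {h h' : V}
    (hh : ¬ Hits T h {p | Outer K p}) (hadj : G.Adj h h') :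
    ∃ p ∈ T h, ∃ q ∈ T h', p = q ∨ HexAdj (gridCoord p) (gridCoord q) := by
  obtain ⟨p, hp, q, hq, h | h⟩ := ht.adj hadj
  · exact ⟨p, hp, q, hq, .inl h⟩
  · exact ⟨p, hp, q, hq, .inr
      (hexAdj_of_triangulatedGridSimple_adj hK h (fun hO => hh ⟨_, hp, hO⟩))⟩

end IsGridTrace

/-! ### Labels of centres and the boundary of the square. -/

/-- The vertex of the `n × n` grid with index `y ∈ {1, …, n}²`; all other indices are sent to the
corner. -/
noncomputable def gridLabel {n : ℕ} (hn : 1 ≤ n) (y : ℤ × ℤ) : Fin n × Fin n :=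
  open Classical in
  if Outer (n + 1) y then (⟨n - 1, by omega⟩, ⟨n - 1, by omega⟩)
  else (⟨min (n - 1) (y.1 - 1).toNat, by omega⟩, ⟨min (n - 1) (y.2 - 1).toNat, by omega⟩)

/-- The corner of the grid that is adjacent to its whole boundary. -/
def gridCorner {n : ℕ} (hn : 1 ≤ n) : Fin n × Fin n := (⟨n - 1, by omega⟩, ⟨n - 1, by omega⟩)

lemma gridLabel_outer {n : ℕ} (hn : 1 ≤ n) {y : ℤ × ℤ} (hy : Outer (n + 1) y) :
    gridLabel hn y = gridCorner hn := by
  unfold gridLabel gridCorner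
  rw [if_pos hy]

lemma gridLabel_inner {n : ℕ} (hn : 1 ≤ n) {y : ℤ × ℤ} (hy : ¬ Outer (n + 1) y) :
    ((gridLabel hn y).1.val : ℤ) = y.1 - 1 ∧ ((gridLabel hn y).2.val : ℤ) = y.2 - 1 := by
  unfold gridLabel
  rw [if_neg hy]
  unfold Outer at hy
  simp only
  omega

lemma gridLabel_boundary {n : ℕ} (hn : 1 ≤ n) {y : ℤ × ℤ}
    (hy : y.1 ≤ 1 ∨ y.2 ≤ 1 ∨ n ≤ y.1 ∨ n ≤ y.2) :
    gridLabel hn y = gridCorner hn ∨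
      (triangulatedGridSimple n).Adj (gridLabel hn y) (gridCorner hn) := by
  by_cases ho : Outer (n + 1) y
  · exact .inl (gridLabel_outer hn ho)
  · obtain ⟨h1, h2⟩ := gridLabel_inner hn ho
    unfold Outer at ho
    refine triangulatedGridSimple_corner ?_ ?_
    · unfold gridCorner; simp only; omega
    · omega

/-- A neighbour of an outer index is outer or in a boundary row, and the corner of the small grid is
adjacent to all of its other boundary vertices. -/
lemma gridLabel_eq_or_adj {n : ℕ} (hn : 1 ≤ n) {y z : ℤ × ℤ} (h : y = z ∨ HexAdj y z) :
    gridLabel hn y = gridLabel hn z ∨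
      (triangulatedGridSimple n).Adj (gridLabel hn y) (gridLabel hn z) := by
  rcases h with rfl | h
  · exact .inl rfl
  by_cases hy : Outer (n + 1) y
  · rw [gridLabel_outer hn hy]
    have : z.1 ≤ 1 ∨ z.2 ≤ 1 ∨ n ≤ z.1 ∨ n ≤ z.2 := by
      unfold Outer at hy; unfold HexAdj at h; omega
    rcases gridLabel_boundary hn this with e | e
    · exact .inl e.symm
    · exact .inr e.symm
  by_cases hz : Outer (n + 1) z
  · rw [gridLabel_outer hn hz]
    refine gridLabel_boundary hn ?_
    unfold Outer at hz; unfold HexAdj at h; omega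
  right
  apply triangulatedGridSimple_adj_of_hexAdj
  obtain ⟨h1, h2⟩ := gridLabel_inner hn hy
  obtain ⟨h3, h4⟩ := gridLabel_inner hn hz
  unfold gridCoord
  unfold HexAdj at *
  simp only
  omega

/-- Every vertex of the grid is a label. -/
lemma exists_gridLabel {n : ℕ} (hn : 1 ≤ n) (x : Fin n × Fin n) :
    ∃ y : ℤ × ℤ, ¬ Outer (n + 1) y ∧ gridLabel hn y = x := by
  have b1 := x.1.isLt
  have b2 := x.2.isLt
  have ho : ¬ Outer (n + 1) ((x.1.val : ℤ) + 1, (x.2.val : ℤ) + 1) := by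
    unfold Outer; simp only; omega
  refine ⟨_, ho, ?_⟩
  obtain ⟨h1, h2⟩ := gridLabel_inner hn ho
  simp only at h1 h2
  ext <;> omega

/-- The side length of the square inside which the coarse grid is drawn. -/
def sideLength (c n : ℕ) : ℤ := (2 * c + 1) * (n + 1)

lemma outer_center_iff {c n : ℕ} {y : ℤ × ℤ} :
    Outer (sideLength c n) (center c y) ↔ Outer (n + 1) y := by
  have h1 := mul_gap (m := 2 * c + 1) (by omega) y.1 (n + 1)
  have h2 := mul_gap (m := 2 * c + 1) (by omega) y.2 (n + 1)
  have h3 := mul_gap (m := 2 * c + 1) (by omega) y.1 0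
  have h4 := mul_gap (m := 2 * c + 1) (by omega) y.2 0
  unfold Outer center sideLength
  simp only [mul_zero] at *
  generalize (2 * (c : ℤ) + 1) * y.1 = A at *
  generalize (2 * (c : ℤ) + 1) * y.2 = B at *
  generalize (2 * (c : ℤ) + 1) * (n + 1) = D at *
  omega

/-- An inner centre is at least one full mesh `2c+1` away from the outside. -/
lemma outer_of_near {c n : ℕ} {y o : ℤ × ℤ} (ho : Outer (sideLength c n) o)
    (h : HexNear (2 * c) (center c y) o) : Outer (n + 1) y := by
  have h1 := mul_gap (m := 2 * c + 1) (by omega) y.1 (n + 1)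
  have h2 := mul_gap (m := 2 * c + 1) (by omega) y.2 (n + 1)
  have h3 := mul_gap (m := 2 * c + 1) (by omega) y.1 0
  have h4 := mul_gap (m := 2 * c + 1) (by omega) y.2 0
  unfold Outer sideLength at *
  unfold HexNear center at h
  simp only [mul_zero] at *
  generalize (2 * (c : ℤ) + 1) * y.1 = A at *
  generalize (2 * (c : ℤ) + 1) * y.2 = B at *
  generalize (2 * (c : ℤ) + 1) * (n + 1) = D at *
  omega

/-- A centre off the boundary rows is at least two meshes, `4c+2`, away from the outside. -/
lemma boundary_of_near {c n : ℕ} {y o : ℤ × ℤ} (ho : Outer (sideLength c n) o)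
    (h : HexNear (4 * c + 1) (center c y) o) : y.1 ≤ 1 ∨ y.2 ≤ 1 ∨ n ≤ y.1 ∨ n ≤ y.2 := by
  have h1 := mul_gap (m := 2 * c + 1) (by omega) y.1 (n + 1)
  have h2 := mul_gap (m := 2 * c + 1) (by omega) y.2 (n + 1)
  have h3 := mul_gap (m := 2 * c + 1) (by omega) y.1 0
  have h4 := mul_gap (m := 2 * c + 1) (by omega) y.2 0
  unfold Outer sideLength at *
  unfold HexNear center at h
  simp only [mul_zero] at *
  generalize (2 * (c : ℤ) + 1) * y.1 = A at *
  generalize (2 * (c : ℤ) + 1) * y.2 = B at *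
  generalize (2 * (c : ℤ) + 1) * (n + 1) = D at *
  omega

/-- A coarse edge near to an outer point has an outer end. -/
lemma OnEdge.outer {c n : ℕ} {y d p o : ℤ × ℤ} (hd : OutDir d) (hp : OnEdge c y d p)
    (ho : Outer (sideLength c n) o) (h : HexNear c p o) :
    Outer (n + 1) y ∨ Outer (n + 1) (y + d) := by
  rw [← outer_center_iff (c := c), ← outer_center_iff (c := c)]
  by_contra! hcon
  have h1 := mul_gap (m := 2 * c + 1) (by omega) y.1 (n + 1)
  have h2 := mul_gap (m := 2 * c + 1) (by omega) y.2 (n + 1)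
  have h3 := mul_gap (m := 2 * c + 1) (by omega) y.1 0
  have h4 := mul_gap (m := 2 * c + 1) (by omega) y.2 0
  have h5 := mul_gap (m := 2 * c + 1) (by omega) (y + d).1 (n + 1)
  have h6 := mul_gap (m := 2 * c + 1) (by omega) (y + d).2 (n + 1)
  have h7 := mul_gap (m := 2 * c + 1) (by omega) (y + d).1 0
  have h8 := mul_gap (m := 2 * c + 1) (by omega) (y + d).2 0
  obtain ⟨t, ht0, ht1, hp1, hp2⟩ := hp
  unfold Outer sideLength at *
  unfold HexNear at h
  unfold center at hcon
  simp only [mul_zero, Prod.fst_add, Prod.snd_add, mul_add, mul_one] at *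
  generalize (2 * (c : ℤ) + 1) * y.1 = A at *
  generalize (2 * (c : ℤ) + 1) * y.2 = B at *
  generalize (2 * (c : ℤ) + 1) * n = D at *
  rcases hd with rfl | rfl | rfl <;>
    simp only [mul_zero, mul_one, mul_neg] at * <;> omega

/-- A point off the coarse edges that is close to an outer point lies in the open hexagon around
an outer centre. -/
lemma exists_outer_inStar {c n : ℕ} {p o : ℤ × ℤ} (hp : ¬ Outer (sideLength c n) p)
    (he : ¬ ∃ y d, OutDir d ∧ OnEdge c y d p) (ho : Outer (sideLength c n) o)
    (h : HexNear (c + 1) p o) : ∃ y, Outer (n + 1) y ∧ InStar c y p := by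
  have hm : (0 : ℤ) < 2 * c + 1 := by omega
  have e1 := Int.mul_ediv_add_emod p.1 (2 * c + 1)
  have e2 := Int.emod_nonneg p.1 hm.ne'
  have e3 := Int.emod_lt_of_pos p.1 hm
  have f1 := Int.mul_ediv_add_emod p.2 (2 * c + 1)
  have f2 := Int.emod_nonneg p.2 hm.ne'
  have f3 := Int.emod_lt_of_pos p.2 hm
  have e0 : p.1 % (2 * c + 1) ≠ 0 :=
    fun hz => he (exists_onEdge (.inl (Int.dvd_of_emod_eq_zero hz)))
  have f0 : p.2 % (2 * c + 1) ≠ 0 :=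
    fun hz => he (exists_onEdge (.inr (.inl (Int.dvd_of_emod_eq_zero hz))))
  generalize p.1 / (2 * (c : ℤ) + 1) = i at *
  generalize p.1 % (2 * (c : ℤ) + 1) = r at *
  generalize p.2 / (2 * (c : ℤ) + 1) = j at *
  generalize p.2 % (2 * (c : ℤ) + 1) = s at *
  have h1 := mul_gap hm i n
  have h2 := mul_gap hm j n
  have h3 := mul_gap hm i 0
  have h4 := mul_gap hm j 0
  -- The cell of `p` is cut into two triangles by the diagonal from `(i, j + 1)` to `(i + 1, j)`;
  -- both triangles have these two corners, so `p` lies in both hexagons.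
  have star1 : InStar c (i, j + 1) p := by
    unfold InStar HexNear center
    simp only [mul_add, mul_one]
    omega
  have star2 : InStar c (i + 1, j) p := by
    unfold InStar HexNear center
    simp only [mul_add, mul_one]
    omega
  -- Being within `c+1` of the outside forces the cell to touch the boundary of the square, and then
  -- an end of its diagonal is outer.
  have : Outer (n + 1) (i, j + 1) ∨ Outer (n + 1) (i + 1, j) := by
    unfold Outer sideLength at *
    unfold HexNear at h
    simp only [mul_zero, mul_add, mul_one] at *
    generalize (2 * (c : ℤ) + 1) * i = A at *
    generalize (2 * (c : ℤ) + 1) * j = B at *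
    generalize (2 * (c : ℤ) + 1) * n = D at *
    omega
  rcases this with h | h
  · exact ⟨_, h, star1⟩
  · exact ⟨_, h, star2⟩

/-- The centre of an arm through an inner point lies in the closed square. -/
lemma center_mem_of_near {c n : ℕ} {y p : ℤ × ℤ} (hp : ¬ Outer (sideLength c n) p)
    (h : HexNear (2 * c) (center c y) p) :
    (0 ≤ (center c y).1 ∧ (center c y).1 ≤ sideLength c n) ∧
      (0 ≤ (center c y).2 ∧ (center c y).2 ≤ sideLength c n) := by
  have h1 := mul_gap (m := 2 * c + 1) (by omega) y.1 (n + 1)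
  have h2 := mul_gap (m := 2 * c + 1) (by omega) y.2 (n + 1)
  have h3 := mul_gap (m := 2 * c + 1) (by omega) y.1 0
  have h4 := mul_gap (m := 2 * c + 1) (by omega) y.2 0
  unfold Outer sideLength at *
  unfold HexNear center at *
  simp only [mul_zero] at *
  generalize (2 * (c : ℤ) + 1) * y.1 = A at *
  generalize (2 * (c : ℤ) + 1) * y.2 = B at *
  generalize (2 * (c : ℤ) + 1) * (n + 1) = D at *
  omega

/-! ### Construction of the labelling in three stages. -/

namespace IsGridTrace

variable {V : Type*} {G : SimpleGraph V} {c k n : ℕ} {T : V → Set (Fin k × Fin k)}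

/-- Walks along coarse lines of the grid lift to the traced graph. -/
lemma joined_segment (ht : IsGridTrace G c k T) {y d : ℤ × ℤ} (hd : OutDir d) {s t : ℤ}
    (hst : s ≤ t) {p q : Fin k × Fin k} (hp : AtParam c y d s (gridCoord p))
    (hq : AtParam c y d t (gridCoord q)) {h h' : V} (hh : p ∈ T h) (hh' : q ∈ T h') :
    G.JoinedWithin {g | Hits T g {x | ∃ u : ℤ, s ≤ u ∧ u ≤ t ∧ AtParam c y d u x}} h h' := by
  obtain ⟨N, rfl⟩ := Int.le.dest hst
  exact ht.joined (segment_joined hd hp N hq) ⟨s, le_rfl, by omega, hp⟩ hh hh'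

lemma joined_univ (ht : IsGridTrace G c k T) (hn : 1 ≤ n) (hk : sideLength c n ≤ k - 1)
    (h h' : V) : G.JoinedWithin Set.univ h h' := by
  have h1 : (0 : ℤ) < sideLength c n := by unfold sideLength; positivity
  obtain ⟨w, hw⟩ := exists_gridCoord (k := k) ((k : ℤ) - 1, (k : ℤ) - 1)
    (by simp only; omega) (by simp only; omega)
  simp only [gridCoord, Prod.mk.injEq] at hw
  obtain ⟨hw', hw0⟩ := ht.cover w
  have key : ∀ g, G.JoinedWithin Set.univ g hw' := by
    intro g
    obtain ⟨p, hp⟩ := ht.nonempty g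
    -- With `K = 0` every grid point counts as outer, so this is connectedness of the whole grid.
    have hj : (triangulatedGridSimple k).JoinedWithin Set.univ p w :=
      (outer_joined_corner (K := 0) (by omega) (by omega)
        (.inr (.inr (.inl (by simp [gridCoord]))))).mono (Set.subset_univ _)
    exact (ht.joined hj trivial hp hw0).mono (Set.subset_univ _)
  exact (key h).trans (key h').symm

/-- The vertices from which the labelling starts. -/
def Seed (T : V → Set (Fin k × Fin k)) (c n : ℕ) : Set V :=
  {h | Hits T h {p | Outer (sideLength c n) p} ∨ ∃ y, Hits T h {p | InArm c y p}}

/-- Labellings of seeds by the arms, or the outside, on which they are traced. -/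
structure IsLabelling (T : V → Set (Fin k × Fin k)) (c : ℕ) (hn : 1 ≤ n)
    (τ : V → Fin n × Fin n) : Prop where
  outer : ∀ h, Hits T h {p | Outer (sideLength c n) p} → τ h = gridCorner hn
  arm : ∀ h y, Hits T h {p | InArm c y p} → τ h = gridLabel hn y

/-- The label of `h` is that of a centre whose open hexagon contains the trace of `h`. -/
def StarLabelled (T : V → Set (Fin k × Fin k)) (c : ℕ) (hn : 1 ≤ n) (h : V)
    (x : Fin n × Fin n) : Prop :=
  ∃ y, gridLabel hn y = x ∧ ∀ p ∈ T h, InStar c y (gridCoord p)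

/-- No conflict arises: a trace inside the square meets the arms of at most one centre, and an arm
met by a trace that also goes outside has an outer centre, whose label is the corner. -/
lemma exists_seed_labelling (ht : IsGridTrace G c k T) (hn : 1 ≤ n)
    (hk : sideLength c n ≤ k - 1) : ∃ τ : V → Fin n × Fin n, IsLabelling T c hn τ := by
  classical
  let τ : V → Fin n × Fin n := fun h =>
    if hO : Hits T h {p | Outer (sideLength c n) p} then gridCorner hn
    else if ha : ∃ y, Hits T h {p | InArm c y p} then gridLabel hn ha.choose
    else gridCorner hn
  refine ⟨τ, fun h hh => dif_pos hh, ?_⟩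
  intro h y hh
  by_cases hO : Hits T h {p | Outer (sideLength c n) p}
  · obtain ⟨p, hp, hpy⟩ := hh
    obtain ⟨o, ho, hpo⟩ := ht.near_outer hk hO hp
    have hy : Outer (n + 1) y :=
      outer_of_near ho ((InArm.near hpy |>.trans hpo).mono (by omega))
    rw [gridLabel_outer hn hy]
    exact dif_pos hO
  · have ha : ∃ y, Hits T h {p | InArm c y p} := ⟨y, hh⟩
    have hval : τ h = gridLabel hn ha.choose := by
      simp only [τ, dif_neg hO, dif_pos ha]
    rw [hval]
    obtain ⟨p, hp, hpy⟩ := hh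
    obtain ⟨q, hq, hqy⟩ := ha.choose_spec
    rw [InArm.eq_of_near hqy hpy (ht.near hk hO hq hp)]

lemma starLabelled_of_arm (ht : IsGridTrace G c k T) (hn : 1 ≤ n) (hk : sideLength c n ≤ k - 1)
    {h : V} (hO : ¬ Hits T h {p | Outer (sideLength c n) p}) {y : ℤ × ℤ}
    (hy : Hits T h {p | InArm c y p}) : StarLabelled T c hn h (gridLabel hn y) := by
  obtain ⟨p, hp, hpy⟩ := hy
  refine ⟨y, rfl, fun q hq => ?_⟩
  exact ((InArm.near hpy).trans (ht.near hk hO hp hq)).mono (by omega)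

/-- A vertex that is traced on a coarse edge without being a seed is traced in the open rhombus
around that edge. -/
lemma inStar_of_onEdge (ht : IsGridTrace G c k T) (hk : sideLength c n ≤ k - 1)
    {h : V} (hS : h ∉ Seed T c n) {y d : ℤ × ℤ} (hd : OutDir d) (he : Hits T h {p | OnEdge c y d p}) :
    ∀ p ∈ T h, InStar c y (gridCoord p) ∧ InStar c (y + d) (gridCoord p) := by
  have hO : ¬ Hits T h {p | Outer (sideLength c n) p} := fun hh => hS (.inl hh)
  have hA : ∀ p ∈ T h, ¬ ∃ z, InArm c z (gridCoord p) :=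
    fun p hp ⟨z, hz⟩ => hS (.inr ⟨z, p, hp, hz⟩)
  obtain ⟨p, hp, hpe⟩ := he
  rcases OnEdge.cases hd hpe with hz | hz | ⟨t, h1, h2, h3⟩
  · exact absurd ⟨_, hz⟩ (hA p hp)
  · exact absurd ⟨_, hz⟩ (hA p hp)
  intro q hq
  refine ht.invariant hk hO (P := fun x => InStar c y x ∧ InStar c (y + d) x) hp hq ?_ ?_
  · exact ⟨h3.near hd (by omega) (by omega), h3.head.near hd (by omega) (by omega)⟩
  · intro a ha b hb hPa hab
    exact rhombus_step hd h1 h2 h3 hPa hab (ht.near hk hO hp hb) (hA b hb)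

lemma IsLabelling.congr {hn : 1 ≤ n} {τ τ' : V → Fin n × Fin n} (h : IsLabelling T c hn τ)
    (hτ : ∀ v ∈ Seed T c n, τ' v = τ v) : IsLabelling T c hn τ' :=
  ⟨fun v hv => (hτ v (.inl hv)).trans (h.outer v hv),
    fun v y hv => (hτ v (.inr ⟨y, hv⟩)).trans (h.arm v y hv)⟩

/-- The vertices traced on a coarse edge. -/
def Skeletal (T : V → Set (Fin k × Fin k)) (c : ℕ) : Set V :=
  {h | ∃ y d, OutDir d ∧ Hits T h {p | OnEdge c y d p}}

/-- Labels spread between adjacent vertices traced on a common coarse edge. Non-seeds stay in the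
rhombus of that edge, so a chain of links never changes edge, and the seed it reaches carries the
label of an end of it. Both ends are admissible for `h`. -/
lemma exists_skeletal_labelling (ht : IsGridTrace G c k T) (hn : 1 ≤ n)
    (hk : sideLength c n ≤ k - 1) : ∃ τ : V → Fin n × Fin n, IsLabelling T c hn τ ∧
      ∀ h ∈ Skeletal T c, h ∉ Seed T c n → StarLabelled T c hn h (τ h) ∧
        ∃ g ∈ Seed T c n, τ g = τ h ∧
          G.JoinedWithin {w | τ w = τ h ∧ (w ∈ Seed T c n ∨ w ∈ Skeletal T c)} h g := by
  obtain ⟨τ₀, hτ₀⟩ := ht.exists_seed_labelling hn hk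
  let N : V → V → Prop := fun a b => G.Adj a b ∧ ∃ y d, OutDir d ∧
    Hits T a {p | OnEdge c y d p} ∧ Hits T b {p | OnEdge c y d p}
  obtain ⟨τ, hτS, hτ⟩ := exists_extension G (Seed T c n) τ₀ N
    (fun a b ⟨h, y, d, hd, h1, h2⟩ => ⟨h.symm, y, d, hd, h2, h1⟩) (fun a b h => h.1)
  have hlab : IsLabelling T c hn τ := hτ₀.congr hτS
  refine ⟨τ, hlab, ?_⟩
  rintro h ⟨y, d, hd, he⟩ hS
  have hO : ¬ Hits T h {p | Outer (sideLength c n) p} := fun hh => hS (.inl hh)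
  have hstar := ht.inStar_of_onEdge hk hS hd he
  -- The coarse edge is followed back to its tail `y`, which lies in the grid and whose vertex is a
  -- seed.
  have hreach : ∃ g ∈ Seed T c n, Relation.ReflTransGen (fun a b => a ∉ Seed T c n ∧ N a b) h g := by
    obtain ⟨p, hp, u, hu0, hu1, hpu⟩ := he
    have hbox := center_mem_of_near (fun hh => hO ⟨p, hp, hh⟩) (hstar p hp).1
    obtain ⟨q, hq⟩ := exists_gridCoord (k := k) (center c y) (by omega) (by omega)
    obtain ⟨h', hh'⟩ := ht.cover q
    have hj := ht.joined_segment hd hu0 (p := q) (q := p)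
      (by rw [hq]; simp [AtParam, center]) hpu hh' hp
    obtain ⟨g, hg, hchain⟩ := hj.symm.exists_first (S := Seed T c n)
      (.inr ⟨y, q, hh', by rw [hq]; exact inArm_center c y⟩)
    refine ⟨g, hg, Relation.ReflTransGen.mono ?_ _ _ hchain⟩
    rintro a b ⟨ha, hab, ⟨p1, hp1, v1, hv1⟩, ⟨p2, hp2, v2, hv2⟩⟩
    exact ⟨ha, hab, y, d, hd, ⟨p1, hp1, v1, by omega, by omega, hv1.2.2⟩,
      ⟨p2, hp2, v2, by omega, by omega, hv2.2.2⟩⟩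
  obtain ⟨g, hg, hchain, hval, hjoin⟩ := hτ h hS hreach
  -- The edges of successive links coincide: a point of the next edge lies in the hexagons of both
  -- ends of the present one, and `edge_eq` applies.
  have hge : Hits T g {p | OnEdge c y d p} := by
    clear hval hjoin hg
    induction hchain with
    | refl => exact he
    | @tail a b _ hab ih =>
      obtain ⟨ha, _, z, e, hee, ⟨q, hq, hqe⟩, hb⟩ := hab
      have hs := ht.inStar_of_onEdge hk ha hd ih q hq
      obtain ⟨rfl, rfl⟩ := hd.edge_eq hee (hs.1.eq_or_eq hee hqe) (hs.2.eq_or_eq hee hqe)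
      exact hb
  refine ⟨?_, g, hg, (hτS g hg).trans hval.symm, hjoin.mono ?_⟩
  · rw [hval, ← hτS g hg]
    by_cases hgO : Hits T g {p | Outer (sideLength c n) p}
    · rw [hlab.outer g hgO]
      obtain ⟨p, hp, hpe⟩ := hge
      obtain ⟨o, ho, hpo⟩ := ht.near_outer hk hgO hp
      rcases OnEdge.outer hd hpe ho hpo with hy | hy
      · exact ⟨y, gridLabel_outer hn hy, fun p hp => (hstar p hp).1⟩
      · exact ⟨y + d, gridLabel_outer hn hy, fun p hp => (hstar p hp).2⟩
    · rcases hg with hg | ⟨z, hz⟩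
      · exact absurd hg hgO
      rw [hlab.arm g z hz]
      obtain ⟨p, hp, hpe⟩ := hge
      obtain ⟨q, hq, hqz⟩ := hz
      have hzp : InStar c z (gridCoord p) :=
        ((InArm.near hqz).trans (ht.near hk hgO hq hp)).mono (by omega)
      rcases hzp.eq_or_eq hd hpe with rfl | rfl
      · exact ⟨_, rfl, fun p hp => (hstar p hp).1⟩
      · exact ⟨_, rfl, fun p hp => (hstar p hp).2⟩
  · rintro w ⟨hw1, hw2⟩
    refine ⟨hw1, ?_⟩
    rcases hw2 with hw | ⟨x, _, z, e, hee, hw, _⟩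
    · exact .inl hw
    · exact .inr ⟨z, e, hee, hw⟩

/-- A vertex left over has its trace off all coarse edges, so the hexagon of a neighbour's label,
once entered, contains the whole trace. Next to an outer vertex, `exists_outer_inStar` supplies an
outer centre instead. -/
lemma exists_labelling (ht : IsGridTrace G c k T) (hn : 1 ≤ n)
    (hk : sideLength c n ≤ k - 1) : ∃ τ : V → Fin n × Fin n, IsLabelling T c hn τ ∧
      (∀ h, ¬ Hits T h {p | Outer (sideLength c n) p} → StarLabelled T c hn h (τ h)) ∧
      ∀ h, ∃ g ∈ Seed T c n, τ g = τ h ∧ G.JoinedWithin {w | τ w = τ h} h g := by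
  obtain ⟨τ₀, hτ₀, hskel⟩ := ht.exists_skeletal_labelling hn hk
  obtain ⟨τ, hτS, hτ⟩ := exists_extension G (Seed T c n ∪ Skeletal T c) τ₀ G.Adj
    (fun a b h => h.symm) (fun a b h => h)
  have hlab : IsLabelling T c hn τ := hτ₀.congr (fun v hv => hτS v (.inl hv))
  have hstar : ∀ h ∈ Seed T c n ∪ Skeletal T c, ¬ Hits T h {p | Outer (sideLength c n) p} →
      StarLabelled T c hn h (τ h) := by
    intro h hh hO
    by_cases hS : h ∈ Seed T c n
    · rcases hS with hS | ⟨y, hy⟩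
      · exact absurd hS hO
      · rw [hlab.arm h y hy]
        exact ht.starLabelled_of_arm hn hk hO hy
    · rw [hτS h hh]
      exact (hskel h (hh.resolve_left hS) hS).1
  have hbase : ∀ h ∈ Seed T c n ∪ Skeletal T c,
      ∃ g ∈ Seed T c n, τ g = τ h ∧ G.JoinedWithin {w | τ w = τ h} h g := by
    intro h hh
    by_cases hS : h ∈ Seed T c n
    · exact ⟨h, hS, rfl, Relation.ReflTransGen.refl⟩
    · obtain ⟨-, g, hg, hgh, hj⟩ := hskel h (hh.resolve_left hS) hS
      refine ⟨g, hg, by rw [hτS g (.inl hg), hτS h hh, hgh], hj.mono ?_⟩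
      rintro w ⟨hw, hw'⟩
      change τ w = τ h
      rw [hτS w hw', hτS h hh, hw]
  -- The grid point `(0, 0)` is outer, so any vertex traced there is a seed.
  obtain ⟨g₀, hg₀⟩ : ∃ g₀, g₀ ∈ Seed T c n := by
    have h1 : (0 : ℤ) < sideLength c n := by unfold sideLength; positivity
    obtain ⟨q, hq⟩ := exists_gridCoord (k := k) (0, 0) (by simp only; omega) (by simp only; omega)
    obtain ⟨g, hg⟩ := ht.cover q
    exact ⟨g, .inl ⟨q, hg, by rw [hq]; exact .inl le_rfl⟩⟩
  have hreach : ∀ h, ∃ g ∈ Seed T c n ∪ Skeletal T c,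
      Relation.ReflTransGen (fun a b => a ∉ Seed T c n ∪ Skeletal T c ∧ G.Adj a b) h g := by
    intro h
    obtain ⟨g, hg, hchain⟩ := (ht.joined_univ hn hk h g₀).exists_first
      (S := Seed T c n ∪ Skeletal T c) (.inl hg₀)
    exact ⟨g, hg, Relation.ReflTransGen.mono (fun a b hab => ⟨hab.1, hab.2.1⟩) _ _ hchain⟩
  refine ⟨τ, hlab, ?_, ?_⟩
  · intro h hO
    by_cases hh : h ∈ Seed T c n ∪ Skeletal T c
    · exact hstar h hh hO
    obtain ⟨g, hg, hchain, hval, -⟩ := hτ h hh (hreach h)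
    rw [hval, ← hτS g hg]
    clear hval hO
    induction hchain using Relation.ReflTransGen.head_induction_on with
    | refl => exact absurd hg hh
    | @head a b hab hbg ih =>
      have ha := hab.1
      have haO : ¬ Hits T a {p | Outer (sideLength c n) p} := fun h => ha (.inl (.inl h))
      have hoff : ∀ p ∈ T a, ¬ ∃ y d, OutDir d ∧ OnEdge c y d (gridCoord p) :=
        fun p hp ⟨y, d, hd, he⟩ => ha (.inr ⟨y, d, hd, p, hp, he⟩)
      have spread : ∀ y p, p ∈ T a → InStar c y (gridCoord p) →
          ∀ q ∈ T a, InStar c y (gridCoord q) := fun y p hp hpy q hq =>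
        ht.invariant hk haO (P := InStar c y) hp hq hpy
          (fun _ _ b hb hPa hab => hPa.step hab (hoff b hb))
      obtain ⟨p, hp, q, hq, hpq⟩ := ht.hexAdj_of_adj hk haO hab.2
      by_cases hbO : Hits T b {p | Outer (sideLength c n) p}
      · have hbg' : b = g := by
          rcases hbg.cases_head with h | ⟨x, hx, _⟩
          · exact h
          · exact absurd (.inl (.inl hbO)) hx.1
        subst hbg'
        rw [hlab.outer b hbO]
        obtain ⟨o, ho, hqo⟩ := ht.near_outer hk hbO hq
        have hpo : HexNear (c + 1) (gridCoord p) o := by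
          rcases hpq with rfl | hpq
          · exact hqo.mono (by omega)
          · exact (hpq.near.trans hqo).mono (by omega)
        obtain ⟨y, hy, hyp⟩ := exists_outer_inStar (fun h => haO ⟨p, hp, h⟩) (hoff p hp) ho hpo
        exact ⟨y, gridLabel_outer hn hy, spread y p hp hyp⟩
      · have hb : StarLabelled T c hn b (τ g) := by
          by_cases hbS : b ∈ Seed T c n ∪ Skeletal T c
          · have hbg' : b = g := by
              rcases hbg.cases_head with h | ⟨x, hx, _⟩
              · exact h
              · exact absurd hbS hx.1
            subst hbg'
            exact hstar b hbS hbO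
          · exact ih hbS
        obtain ⟨y, hy, hyb⟩ := hb
        refine ⟨y, hy, spread y p hp ?_⟩
        rcases hpq with rfl | hpq
        · exact hyb p hq
        · exact (hyb q hq).step hpq.symm (hoff p hp)
  · intro h
    by_cases hh : h ∈ Seed T c n ∪ Skeletal T c
    · exact hbase h hh
    obtain ⟨g, hg, hchain, hval, hj⟩ := hτ h hh (hreach h)
    obtain ⟨g', hg', hgg', hj'⟩ := hbase g hg
    have hgh : τ g = τ h := (hτS g hg).trans hval.symm
    refine ⟨g', hg', hgg'.trans hgh, (hj.mono fun w hw => hw.1).trans ?_⟩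
    rw [← hgh]
    exact hj'

end IsGridTrace

/-! ### Connectedness and adjacency of the label classes. -/

/-- `x` and `z` are the labels of the ends of a coarse edge in the closed square. -/
def EndLabels {n : ℕ} (hn : 1 ≤ n) (x z : Fin n × Fin n) : Prop :=
  ∃ y d : ℤ × ℤ, OutDir d ∧ (0 ≤ y.1 ∧ y.1 ≤ n + 1) ∧ (0 ≤ y.2 ∧ y.2 ≤ n + 1) ∧
    (0 ≤ (y + d).1 ∧ (y + d).1 ≤ n + 1) ∧ (0 ≤ (y + d).2 ∧ (y + d).2 ≤ n + 1) ∧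
    ((gridLabel hn y = x ∧ gridLabel hn (y + d) = z) ∨
      (gridLabel hn y = z ∧ gridLabel hn (y + d) = x))

lemma endLabels_of_adj {n : ℕ} (hn : 1 ≤ n) {x z : Fin n × Fin n}
    (h : (triangulatedGridSimple n).Adj x z) : EndLabels hn x z := by
  have hinner : ∀ x : Fin n × Fin n, ∀ y : ℤ × ℤ, y.1 = x.1.val + 1 → y.2 = x.2.val + 1 →
      gridLabel hn y = x := by
    intro x y h1 h2
    have ho : ¬ Outer (n + 1) y := by unfold Outer; omega
    obtain ⟨h3, h4⟩ := gridLabel_inner hn ho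
    ext <;> omega
  have houter : ∀ x : Fin n × Fin n, (x.1.val + 1 = n ∧ x.2.val + 1 = n) → ∀ y : ℤ × ℤ,
      Outer (n + 1) y → gridLabel hn y = x := by
    intro x hx y hy
    rw [gridLabel_outer hn hy]
    unfold gridCorner
    ext <;> simp only <;> omega
  have main : ∀ x z : Fin n × Fin n,
      (|(x.1.val : ℤ) - (z.1.val : ℤ)| + |(x.2.val : ℤ) - (z.2.val : ℤ)| = 1 ∨
      (x.1.val = z.1.val + 1 ∧ z.2.val = x.2.val + 1) ∨
      ((x.1.val + 1 = n ∧ x.2.val + 1 = n) ∧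
        (z.1.val = 0 ∨ z.1.val + 1 = n ∨ z.2.val = 0 ∨ z.2.val + 1 = n))) →
      EndLabels hn x z := by
    intro x z h
    have hx1 := x.1.isLt
    have hx2 := x.2.isLt
    have hz1 := z.1.isLt
    have hz2 := z.2.isLt
    have hx := hinner x
    have hz := hinner z
    have inner : ∀ d, OutDir d → ((z.1.val : ℤ) = x.1.val + d.1 ∧ (z.2.val : ℤ) = x.2.val + d.2) →
        EndLabels hn x z := by
      intro d hd ⟨h1, h2⟩
      refine ⟨((x.1.val : ℤ) + 1, (x.2.val : ℤ) + 1), d, hd, ?_, ?_, ?_, ?_,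
        .inl ⟨hx _ rfl rfl, hz _ ?_ ?_⟩⟩ <;>
      simp only [Prod.fst_add, Prod.snd_add] <;> omega
    have inner' : ∀ d, OutDir d → ((x.1.val : ℤ) = z.1.val + d.1 ∧ (x.2.val : ℤ) = z.2.val + d.2) →
        EndLabels hn x z := by
      intro d hd ⟨h1, h2⟩
      refine ⟨((z.1.val : ℤ) + 1, (z.2.val : ℤ) + 1), d, hd, ?_, ?_, ?_, ?_,
        .inr ⟨hz _ rfl rfl, hx _ ?_ ?_⟩⟩ <;>
      simp only [Prod.fst_add, Prod.snd_add] <;> omega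
    rcases h with h | h | ⟨hc, h⟩
    · rw [abs_eq_max_neg, abs_eq_max_neg] at h
      have h' : ((z.1.val : ℤ) = x.1.val + 1 ∧ (z.2.val : ℤ) = x.2.val + 0) ∨
          ((x.1.val : ℤ) = z.1.val + 1 ∧ (x.2.val : ℤ) = z.2.val + 0) ∨
          ((z.1.val : ℤ) = x.1.val + 0 ∧ (z.2.val : ℤ) = x.2.val + -1) ∨
          ((x.1.val : ℤ) = z.1.val + 0 ∧ (x.2.val : ℤ) = z.2.val + -1) := by omega
      rcases h' with h' | h' | h' | h'
      · exact inner (1, 0) (.inl rfl) h'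
      · exact inner' (1, 0) (.inl rfl) h'
      · exact inner (0, -1) (.inr (.inr rfl)) h'
      · exact inner' (0, -1) (.inr (.inr rfl)) h'
    · exact inner (-1, 1) (.inr (.inl rfl)) ⟨by simp only; omega, by simp only; omega⟩
    -- Edges at the corner come from coarse edges crossing the border between the inner centres and
    -- rows or columns `0` and `n + 1`, one case for each side.
    · have ho := houter x hc
      rcases h with h | h | h | h
      · refine ⟨(0, (z.2.val : ℤ) + 1), (1, 0), .inl rfl, ?_, ?_, ?_, ?_,
          .inl ⟨ho _ (.inl le_rfl), hz _ ?_ ?_⟩⟩ <;>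
        simp only [Prod.fst_add, Prod.snd_add] <;> omega
      · refine ⟨((z.1.val : ℤ) + 1, (z.2.val : ℤ) + 1), (1, 0), .inl rfl, ?_, ?_, ?_, ?_,
          .inr ⟨hz _ ?_ ?_, ho _ (.inr (.inr (.inl ?_)))⟩⟩ <;>
        simp only [Prod.fst_add, Prod.snd_add] <;> omega
      · refine ⟨((z.1.val : ℤ) + 1, (z.2.val : ℤ) + 1), (0, -1), .inr (.inr rfl), ?_, ?_, ?_, ?_,
          .inr ⟨hz _ ?_ ?_, ho _ (.inr (.inl ?_))⟩⟩ <;>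
        simp only [Prod.fst_add, Prod.snd_add] <;> omega
      · refine ⟨((z.1.val : ℤ) + 1, (n : ℤ) + 1), (0, -1), .inr (.inr rfl), ?_, ?_, ?_, ?_,
          .inl ⟨ho _ (.inr (.inr (.inr ?_))), hz _ ?_ ?_⟩⟩ <;>
        simp only [Prod.fst_add, Prod.snd_add] <;> omega
  unfold triangulatedGridSimple at h
  rw [SimpleGraph.fromRel_adj] at h
  rcases h.2 with h | h
  · exact main x z h
  · obtain ⟨y, d, h1, h2, h3, h4, h5, h6⟩ := main z x h
    exact ⟨y, d, h1, h2, h3, h4, h5, h6.symm⟩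

namespace IsGridTrace

variable {V : Type*} {G : SimpleGraph V} {c k n : ℕ} {T : V → Set (Fin k × Fin k)}
  {τ : V → Fin n × Fin n}

lemma exists_at_center (ht : IsGridTrace G c k T) (hk : sideLength c n ≤ k - 1) {y : ℤ × ℤ}
    (h1 : 0 ≤ y.1 ∧ y.1 ≤ n + 1) (h2 : 0 ≤ y.2 ∧ y.2 ≤ n + 1) :
    ∃ q h, q ∈ T h ∧ gridCoord q = center c y := by
  have e : ∀ a : ℤ, 0 ≤ a ∧ a ≤ n + 1 →
      0 ≤ (2 * (c : ℤ) + 1) * a ∧ (2 * (c : ℤ) + 1) * a < k := by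
    rintro a ⟨ha, ha'⟩
    unfold sideLength at hk
    constructor <;> nlinarith
  obtain ⟨q, hq⟩ := exists_gridCoord (k := k) (center c y) (e _ h1) (e _ h2)
  obtain ⟨h, hh⟩ := ht.cover q
  exact ⟨q, h, hh, hq⟩

/-- A vertex traced on a coarse edge has the label of one of its ends. -/
lemma label_of_onEdge (ht : IsGridTrace G c k T) (hn : 1 ≤ n) (hk : sideLength c n ≤ k - 1)
    (hlab : IsLabelling T c hn τ)
    (hstar : ∀ h, ¬ Hits T h {p | Outer (sideLength c n) p} → StarLabelled T c hn h (τ h))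
    {h : V} {y d : ℤ × ℤ} (hd : OutDir d) (he : Hits T h {p | OnEdge c y d p}) :
    τ h = gridLabel hn y ∨ τ h = gridLabel hn (y + d) := by
  obtain ⟨p, hp, hpe⟩ := he
  by_cases hO : Hits T h {p | Outer (sideLength c n) p}
  · rw [hlab.outer h hO]
    obtain ⟨o, ho, hpo⟩ := ht.near_outer hk hO hp
    exact (OnEdge.outer hd hpe ho hpo).imp (fun h => (gridLabel_outer hn h).symm)
      (fun h => (gridLabel_outer hn h).symm)
  · obtain ⟨z, hz, hzT⟩ := hstar h hO
    rw [← hz]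
    exact ((hzT p hp).eq_or_eq hd hpe).imp (fun h => by rw [h]) (fun h => by rw [h])

lemma joined_edge (ht : IsGridTrace G c k T) (hn : 1 ≤ n) (hk : sideLength c n ≤ k - 1)
    (hlab : IsLabelling T c hn τ)
    (hstar : ∀ h, ¬ Hits T h {p | Outer (sideLength c n) p} → StarLabelled T c hn h (τ h))
    {y d : ℤ × ℤ} (hd : OutDir d) {p q : Fin k × Fin k} (hp : gridCoord p = center c y)
    (hq : gridCoord q = center c (y + d)) {h h' : V} (hh : p ∈ T h) (hh' : q ∈ T h') :
    G.JoinedWithin {w | τ w = gridLabel hn y ∨ τ w = gridLabel hn (y + d)} h h' := by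
  have := ht.joined_segment hd (y := y) (s := 0) (t := 2 * c + 1) (by omega)
    (by rw [hp]; simp [AtParam, center])
    (by rw [hq]; simp [AtParam, center, mul_add]) hh hh'
  refine this.mono ?_
  rintro w ⟨r, hr, u, hu0, hu1, hu⟩
  exact ht.label_of_onEdge hn hk hlab hstar hd ⟨r, hr, u, hu0, hu1, hu⟩

lemma joined_arm (ht : IsGridTrace G c k T) (hn : 1 ≤ n) (hlab : IsLabelling T c hn τ)
    {y : ℤ × ℤ} {h h' : V} (hy : Hits T h {p | InArm c y p}) {q : Fin k × Fin k} (hq : q ∈ T h')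
    (hqy : gridCoord q = center c y) :
    G.JoinedWithin {w | τ w = gridLabel hn y} h h' := by
  obtain ⟨p, hp, d, hd, t, ht0, ht1, hpt⟩ := hy
  have := ht.joined_segment hd (y := y) (s := -t) (t := 0) (by omega) hpt
    (by rw [hqy]; simp [AtParam, center]) hp hq
  refine this.mono ?_
  rintro w ⟨r, hr, u, hu0, hu1, hu⟩
  exact hlab.arm w y ⟨r, hr, d, hd, -u, by omega, by omega, by simpa using hu⟩

lemma joined_outer (ht : IsGridTrace G c k T) (hn : 1 ≤ n) (hk : sideLength c n ≤ k - 1)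
    (hlab : IsLabelling T c hn τ) {h h' : V} (hO : Hits T h {p | Outer (sideLength c n) p})
    (hO' : Hits T h' {p | Outer (sideLength c n) p}) :
    G.JoinedWithin {w | τ w = gridCorner hn} h h' := by
  obtain ⟨p, hp, hpO⟩ := hO
  obtain ⟨q, hq, hqO⟩ := hO'
  have hk1 := p.1.isLt
  have hw : ((⟨k - 1, by omega⟩, ⟨k - 1, by omega⟩) : Fin k × Fin k).1.val + 1 = k ∧
      ((⟨k - 1, by omega⟩, ⟨k - 1, by omega⟩) : Fin k × Fin k).2.val + 1 = k := by
    constructor <;> simp only <;> omega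
  have hj := (outer_joined_corner hk hw hpO).trans (outer_joined_corner hk hw hqO).symm
  exact (ht.joined hj hpO hp hq).mono (fun w hw => hlab.outer w hw)

/-- Seeds with the same label are joined by a walk with constant label. -/
lemma joined_seed (ht : IsGridTrace G c k T) (hn : 1 ≤ n) (hk : sideLength c n ≤ k - 1)
    (hlab : IsLabelling T c hn τ)
    (hstar : ∀ h, ¬ Hits T h {p | Outer (sideLength c n) p} → StarLabelled T c hn h (τ h))
    {h h' : V} (hS : h ∈ Seed T c n) (hS' : h' ∈ Seed T c n) (hτ : τ h = τ h') :
    G.JoinedWithin {w | τ w = τ h} h h' := by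
  have hcenter : ∀ y : ℤ × ℤ, ¬ Outer (n + 1) y → ∃ q g, q ∈ T g ∧ gridCoord q = center c y :=
    fun y hy => ht.exists_at_center hk (by unfold Outer at hy; omega)
      (by unfold Outer at hy; omega)
  have hne : Hits T h {p | Outer (sideLength c n) p} ∨
      ∃ y, Hits T h {p | InArm c y p} := hS
  by_cases hc : τ h = gridCorner hn
  -- The corner label belongs to the outside and also to the inner centre `(n, n)`; the outer centre
  -- `(n + 1, n)` is chosen since a coarse edge runs to it from `(n, n)`.
  · obtain ⟨q₀, g₀, hq₀, hg₀⟩ := ht.exists_at_center hk (y := ((n : ℤ) + 1, (n : ℤ)))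
      (by simp only; omega) (by simp only; omega)
    have hO₀ : Hits T g₀ {p | Outer (sideLength c n) p} := by
      refine ⟨q₀, hq₀, ?_⟩
      rw [hg₀]
      exact outer_center_iff.2 (.inr (.inr (.inl le_rfl)))
    have key : ∀ g ∈ Seed T c n, τ g = gridCorner hn →
        G.JoinedWithin {w | τ w = gridCorner hn} g g₀ := by
      intro g hg hgc
      by_cases hO : Hits T g {p | Outer (sideLength c n) p}
      · exact ht.joined_outer hn hk hlab hO hO₀
      rcases hg with hg | ⟨y, hy⟩
      · exact absurd hg hO
      have hyc : gridLabel hn y = gridCorner hn := (hlab.arm g y hy).symm.trans hgc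
      by_cases hyO : Outer (n + 1) y
      · obtain ⟨p, hp, hpy⟩ := id hy
        have hbox := center_mem_of_near (fun hh => hO ⟨p, hp, hh⟩)
          ((InArm.near hpy).mono (by omega))
        obtain ⟨q, hq⟩ := exists_gridCoord (k := k) (center c y) (by omega) (by omega)
        obtain ⟨f, hf⟩ := ht.cover q
        have hfO : Hits T f {p | Outer (sideLength c n) p} :=
          ⟨q, hf, by rw [hq]; exact outer_center_iff.2 hyO⟩
        rw [← hyc]
        refine (ht.joined_arm hn hlab hy hf hq).trans ?_
        rw [hyc]
        exact ht.joined_outer hn hk hlab hfO hO₀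
      · obtain ⟨q, f, hf, hq⟩ := hcenter y hyO
        have hyn : y + (1, 0) = ((n : ℤ) + 1, (n : ℤ)) := by
          obtain ⟨h1, h2⟩ := gridLabel_inner hn hyO
          rw [hyc] at h1 h2
          unfold gridCorner at h1 h2
          simp only at h1 h2
          ext
          · simp only [Prod.fst_add]; omega
          · simp only [Prod.snd_add]; omega
        have hlast : gridLabel hn (y + (1, 0)) = gridCorner hn := by
          rw [hyn]; exact gridLabel_outer hn (.inr (.inr (.inl le_rfl)))
        -- Both ends of this coarse edge have the corner label, so the lifted walk never leaves the
        -- class.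
        have := ht.joined_edge hn hk hlab hstar (y := y) (d := (1, 0)) (.inl rfl) hq
          (by rw [hyn]; exact hg₀) hf hq₀
        rw [hlast, hyc] at this
        have h1 := ht.joined_arm hn hlab hy hf hq
        rw [hyc] at h1
        exact h1.trans (this.mono fun w hw => hw.elim id id)
    rw [hc]
    exact (key h hS hc).trans (key h' hS' (hτ.symm.trans hc)).symm
  · have key : ∀ g ∈ Seed T c n, τ g = τ h → ∃ y, ¬ Outer (n + 1) y ∧ gridLabel hn y = τ h ∧
        Hits T g {p | InArm c y p} := by
      intro g hg hgh
      rcases hg with hg | ⟨y, hy⟩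
      · exact absurd (hgh.symm.trans (hlab.outer g hg)) hc
      · have hyh : gridLabel hn y = τ h := (hlab.arm g y hy).symm.trans hgh
        exact ⟨y, fun hO => hc (hyh.symm.trans (gridLabel_outer hn hO)), hyh, hy⟩
    obtain ⟨y, hyO, hyh, hy⟩ := key h hS rfl
    obtain ⟨z, hzO, hzh, hz⟩ := key h' hS' hτ.symm
    have hyz : y = z := by
      obtain ⟨h1, h2⟩ := gridLabel_inner hn hyO
      obtain ⟨h3, h4⟩ := gridLabel_inner hn hzO
      rw [hyh] at h1 h2
      rw [hzh] at h3 h4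
      ext <;> omega
    subst hyz
    obtain ⟨q, f, hf, hq⟩ := hcenter y hyO
    rw [← hyh]
    exact (ht.joined_arm hn hlab hy hf hq).trans (ht.joined_arm hn hlab hz hf hq).symm

/-- Adjacent vertices have equal or adjacent labels. -/
lemma label_eq_or_adj (ht : IsGridTrace G c k T) (hn : 1 ≤ n) (hk : sideLength c n ≤ k - 1)
    (hlab : IsLabelling T c hn τ)
    (hstar : ∀ h, ¬ Hits T h {p | Outer (sideLength c n) p} → StarLabelled T c hn h (τ h))
    {h h' : V} (hadj : G.Adj h h') :
    τ h = τ h' ∨ (triangulatedGridSimple n).Adj (τ h) (τ h') := by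
  have half : ∀ g g', G.Adj g g' → ¬ Hits T g {p | Outer (sideLength c n) p} →
      τ g = τ g' ∨ (triangulatedGridSimple n).Adj (τ g) (τ g') := by
    intro g g' hgg' hO
    obtain ⟨p, hp, q, hq, hpq⟩ := ht.hexAdj_of_adj hk hO hgg'
    have hpq' : HexNear 1 (gridCoord p) (gridCoord q) := by
      rcases hpq with rfl | hpq
      · exact HexNear.refl (by omega) _
      · exact hpq.near
    obtain ⟨y, hy, hyT⟩ := hstar g hO
    by_cases hO' : Hits T g' {p | Outer (sideLength c n) p}
    · obtain ⟨o, ho, hqo⟩ := ht.near_outer hk hO' hq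
      rw [hlab.outer g' hO', ← hy]
      exact gridLabel_boundary hn (boundary_of_near ho
        ((((hyT p hp).trans hpq').trans hqo).mono (by omega)))
    · obtain ⟨z, hz, hzT⟩ := hstar g' hO'
      rw [← hy, ← hz]
      exact gridLabel_eq_or_adj hn (center_gap c y z
        ((((hyT p hp).trans hpq').trans (hzT q hq).symm).mono (by omega)))
  by_cases hO : Hits T h {p | Outer (sideLength c n) p}
  · by_cases hO' : Hits T h' {p | Outer (sideLength c n) p}
    · exact .inl ((hlab.outer h hO).trans (hlab.outer h' hO').symm)
    · exact (half h' h hadj.symm hO').imp Eq.symm SimpleGraph.Adj.symm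
  · exact half h h' hadj hO

/-- A graph with a grid trace contracts to a grid. -/
theorem exists_contractionMap (ht : IsGridTrace G c k T) (hn : 1 ≤ n)
    (hk : sideLength c n ≤ k - 1) :
    ∃ τ : V → Fin n × Fin n, IsContractionMap (triangulatedGridSimple n) G τ := by
  obtain ⟨τ, hlab, hstar, hseed⟩ := ht.exists_labelling hn hk
  have hfiber : ∀ u v, τ u = τ v → G.JoinedWithin {w | τ w = τ u} u v := by
    intro u v huv
    obtain ⟨g, hg, hgu, hjg⟩ := hseed u
    obtain ⟨f, hf, hfv, hjf⟩ := hseed v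
    have := ht.joined_seed hn hk hlab hstar hg hf (by rw [hgu, hfv, huv])
    rw [hgu] at this
    rw [← huv] at hjf
    exact (hjg.trans this).trans hjf.symm
  have hsurj : Function.Surjective τ := by
    intro x
    obtain ⟨y, hyO, rfl⟩ := exists_gridLabel hn x
    obtain ⟨q, h, hh, hq⟩ := ht.exists_at_center hk (y := y) (by unfold Outer at hyO; omega)
      (by unfold Outer at hyO; omega)
    exact ⟨h, hlab.arm h y ⟨q, hh, by rw [hq]; exact inArm_center c y⟩⟩
  refine ⟨τ, hsurj, hfiber, ?_⟩
  intro x z hxz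
  constructor
  · intro hadj
    obtain ⟨y, d, hd, h1, h2, h3, h4, hl⟩ := endLabels_of_adj hn hadj
    obtain ⟨p, g, hg, hp⟩ := ht.exists_at_center hk h1 h2
    obtain ⟨q, f, hf, hq⟩ := ht.exists_at_center hk h3 h4
    have hj := ht.joined_edge hn hk hlab hstar hd hp hq hg hf
    have hg' := hlab.arm g y ⟨p, hg, by rw [hp]; exact inArm_center c y⟩
    have hf' := hlab.arm f (y + d) ⟨q, hf, by rw [hq]; exact inArm_center c _⟩
    obtain ⟨a, b, ha, hb, hab⟩ : ∃ a b, τ a = x ∧ τ b = z ∧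
        G.JoinedWithin (τ ⁻¹' {x} ∪ τ ⁻¹' {z}) a b := by
      rcases hl with ⟨e1, e2⟩ | ⟨e1, e2⟩
      · rw [e1] at hg' hj
        rw [e2] at hf' hj
        exact ⟨g, f, hg', hf', hj⟩
      · rw [e1] at hg' hj
        rw [e2] at hf' hj
        exact ⟨f, g, hf', hg', hj.symm.mono fun w hw => hw.symm⟩
    have key : ∀ u ∈ τ ⁻¹' {x} ∪ τ ⁻¹' {z}, G.JoinedWithin (τ ⁻¹' {x} ∪ τ ⁻¹' {z}) u a := by
      rintro u (hu | hu)
      · refine (hfiber u a (Eq.trans hu ha.symm)).mono fun w hw => .inl ?_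
        exact Eq.trans hw hu
      · refine ((hfiber u b (Eq.trans hu hb.symm)).mono fun w hw => .inr ?_).trans hab.symm
        exact Eq.trans hw hu
    exact fun u hu v hv => (key u hu).trans (key v hv).symm
  · intro h
    by_contra hna
    obtain ⟨u, hu⟩ := hsurj x
    obtain ⟨v, hv⟩ := hsurj z
    have := (h u (.inl hu) v (.inr hv)).invariant (P := fun w => τ w = x) hu ?_
    · exact hxz (this.symm.trans hv)
    · rintro a b ha hab - (hb | hb)
      · exact hb
      · rcases ht.label_eq_or_adj hn hk hlab hstar hab with e | e
        · exact e.symm.trans ha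
        · rw [ha, show τ b = z from hb] at e
          exact absurd e hna

end IsGridTrace

/-! ### Transfer between graphs and their underlying simple graphs. -/

lemma IsDiamContractionVia.isContractionMap {α β α' β' W : Type*} {c : ℕ} {H : Graph α' β'}
    {G : Graph α β} {σ : G.vertexSet → H.vertexSet} (h : IsDiamContractionVia c H G σ)
    (e : H.vertexSet ≃ W) {K : SimpleGraph W}
    (hK : ∀ x y : H.vertexSet, x ≠ y → (K.Adj (e x) (e y) ↔ H.Adj x y)) :
    IsContractionMap K G.toSimpleGraph (e ∘ σ) := by
  obtain ⟨h1, h2, h3⟩ := h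
  have hpre : ∀ x, (e ∘ σ) ⁻¹' {e x} = σ ⁻¹' {x} := by
    intro x; ext v; simp
  refine ⟨e.surjective.comp h1, ?_, ?_⟩
  · intro u v huv
    have hfin := SimpleGraph.preconnected_of_ediam_ne_top
      (ne_top_of_le_ne_top (ENat.natCast_ne_top c) (h2 (σ u)).2)
    rw [Function.comp_apply, hpre]
    exact SimpleGraph.induce_preconnected_iff_joinedWithin.1 hfin u rfl v
      (e.injective huv).symm
  · intro x y hxy
    obtain ⟨x, rfl⟩ := e.surjective x
    obtain ⟨y, rfl⟩ := e.surjective y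
    have hne : x ≠ y := fun hh => hxy (by rw [hh])
    rw [hK x y hne, h3 x y hne, hpre, hpre, SimpleGraph.connected_iff,
      SimpleGraph.induce_preconnected_iff_joinedWithin]
    refine and_iff_left ?_
    obtain ⟨u, hu⟩ := (h2 x).1
    exact ⟨⟨u, .inl hu⟩⟩

/-- By finiteness connected fibres have finite diameter, and the finitely many diameters have a
common bound `M`. -/
lemma IsContractionMap.isContraction {α β α' β' W : Type*} {H : Graph α' β'} {G : Graph α β}
    [Finite G.vertexSet] (e : H.vertexSet ≃ W) {K : SimpleGraph W} {τ : G.vertexSet → W}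
    (h : IsContractionMap K G.toSimpleGraph τ)
    (hK : ∀ x y : H.vertexSet, x ≠ y → (K.Adj (e x) (e y) ↔ H.Adj x y)) :
    IsContraction H G := by
  classical
  have hpre : ∀ x, (e.symm ∘ τ) ⁻¹' {x} = τ ⁻¹' {e x} := by
    intro x; ext v; simp [Equiv.symm_apply_eq]
  have hsurj : Function.Surjective (e.symm ∘ τ) := e.symm.surjective.comp h.surjective
  have hne : ∀ x, ((e.symm ∘ τ) ⁻¹' {x}).Nonempty := fun x => hsurj x
  have hfin : Finite H.vertexSet := Finite.of_surjective _ hsurj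
  have hdiam : ∀ x, ∃ m : ℕ,
      (G.toSimpleGraph.induce ((e.symm ∘ τ) ⁻¹' {x})).ediam = (m : ℕ∞) := by
    intro x
    have : Nonempty ((e.symm ∘ τ) ⁻¹' {x}) := (hne x).to_subtype
    refine ⟨_, (ENat.natCast_toNat (SimpleGraph.connected_iff_ediam_ne_top.1 ?_)).symm⟩
    rw [SimpleGraph.connected_iff]
    refine ⟨SimpleGraph.induce_preconnected_iff_joinedWithin.2 fun u hu v hv => ?_, this⟩
    rw [hpre] at hu hv ⊢
    have := h.fiber u v (Eq.trans hu (Eq.symm hv))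
    rwa [show τ u = e x from hu] at this
  choose m hm using hdiam
  obtain ⟨M, hM⟩ := (Set.finite_range m).bddAbove
  refine ⟨M, e.symm ∘ τ, hsurj, fun x => ⟨hne x, ?_⟩, ?_⟩
  · rw [hm x]
    exact_mod_cast hM ⟨x, rfl⟩
  · intro x y hxy
    rw [← hK x y hxy, h.adj_iff _ _ (e.injective.ne hxy), hpre, hpre, SimpleGraph.connected_iff,
      SimpleGraph.induce_preconnected_iff_joinedWithin]
    refine (and_iff_left ?_).symm
    obtain ⟨u, hu⟩ := h.surjective (e x)
    exact ⟨⟨u, .inl hu⟩⟩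

/-- The fibres of a `c`-diameter contraction trace sets of grid points. -/
lemma isGridTrace_of_contractionMaps {U V : Type*} {A : SimpleGraph U} {B : SimpleGraph V}
    {c k : ℕ} {σ : U → V} {φ : U → Fin k × Fin k} (hσ : IsContractionMap B A σ)
    (hφ : IsContractionMap (triangulatedGridSimple k) A φ)
    (hdiam : ∀ x, (A.induce (σ ⁻¹' {x})).ediam ≤ (c : ℕ∞)) :
    IsGridTrace B c k (fun h => φ '' (σ ⁻¹' {h})) where
  nonempty h := (Set.Nonempty.image φ (hσ.surjective h))
  cover p := by
    obtain ⟨u, hu⟩ := hφ.surjective p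
    exact ⟨σ u, u, rfl, hu⟩
  joined := by
    rintro P _ _ _ _ hpq hp ⟨u, rfl, rfl⟩ ⟨v, rfl, rfl⟩
    refine ((hφ.preimage hpq hp rfl rfl).image fun a b => hσ.eq_or_adj).mono ?_
    rintro _ ⟨w, hw, rfl⟩
    exact ⟨φ w, ⟨w, rfl, rfl⟩, hw⟩
  chain := by
    rintro h _ _ ⟨u, hu, rfl⟩ ⟨v, hv, rfl⟩
    have hd : (A.induce (σ ⁻¹' {h})).edist ⟨u, hu⟩ ⟨v, hv⟩ ≤ (c : ℕ∞) :=
      SimpleGraph.edist_le_ediam.trans (hdiam h)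
    obtain ⟨w, hw⟩ := SimpleGraph.exists_walk_of_edist_ne_top
      (ne_top_of_le_ne_top (ENat.natCast_ne_top c) hd)
    rw [← hw] at hd
    refine ⟨w.length, by exact_mod_cast hd, fun i => φ (w.getVert i), by simp, by simp,
      fun i _ => ⟨_, (w.getVert i).2, rfl⟩, fun i hi => hφ.eq_or_adj (w.adj_getVert_succ hi)⟩
  adj := by
    intro h h' hadj
    -- The union of the two fibres is connected, so some edge of `A` crosses between them; its ends
    -- have equal or adjacent images in the grid.
    by_contra! hcon
    obtain ⟨u, hu⟩ := hσ.surjective h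
    obtain ⟨v, hv⟩ := hσ.surjective h'
    have := ((hσ.adj_iff h h' hadj.ne).1 hadj u (.inl hu) v (.inr hv)).invariant
      (P := fun w => σ w = h) hu ?_
    · exact hadj.ne (this.symm.trans hv)
    · rintro a b ha hab - (hb | hb)
      · exact hb
      · have := hcon _ ⟨a, ha, rfl⟩ _ ⟨b, hb, rfl⟩
        rcases hφ.eq_or_adj hab with e | e
        · exact absurd e this.1
        · exact absurd e this.2

theorem mainTheorem3 {α β α' β' : Type*} (G : Graph α β) (H : Graph α' β')
    [G.Loopless] [H.Loopless] [Finite G.vertexSet] (c k k' : ℕ)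
    (hHG : IsDiamContraction c H G) (hG : IsContraction (triangulatedGrid k) G)
    (hk' : (k' : ℤ) = ⌊((k : ℚ) - 1) / (2 * (c : ℚ) + 1)⌋ - 1) (hk'_pos : 1 ≤ k') :
    IsContraction (triangulatedGrid k') H := by
  obtain ⟨σ, hσ⟩ := hHG
  obtain ⟨_, φ, hφ⟩ := hG
  have hgrid : ∀ n, ∀ x y : (triangulatedGrid n).vertexSet, x ≠ y →
      ((triangulatedGridSimple n).Adj (Equiv.Set.univ _ x) (Equiv.Set.univ _ y) ↔
        (triangulatedGrid n).Adj x y) :=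
    fun n x y _ => (Graph.ofSimpleGraph_adj_iff _ _).symm
  have hσ' := hσ.isContractionMap (Equiv.refl _) (K := H.toSimpleGraph)
    (fun x y _ => Graph.toSimpleGraph_adj_iff x y)
  have hφ' := hφ.isContractionMap (Equiv.Set.univ _) (hgrid k)
  have hfin : Finite H.vertexSet := Finite.of_surjective σ hσ.1
  -- Cleared of the floor, the definition of `k'` yields `(2c+1)(k'+1) ≤ k-1`: the square with its
  -- outer ring of centres fits into the grid.
  have hk : sideLength c k' ≤ k - 1 := by
    have h1 : ((k' : ℤ) + 1) ≤ ⌊((k : ℚ) - 1) / (2 * (c : ℚ) + 1)⌋ := by omega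
    rw [Int.le_floor, le_div_iff₀ (by positivity)] at h1
    unfold sideLength
    have h2 : (((2 * c + 1) * (k' + 1) : ℤ) : ℚ) ≤ ((k - 1 : ℤ) : ℚ) := by
      push_cast at h1 ⊢
      linarith
    exact_mod_cast h2
  obtain ⟨τ, hτ⟩ := (isGridTrace_of_contractionMaps hσ' hφ'
    (fun x => (hσ.2.1 x).2)).exists_contractionMap hk'_pos hk
  exact hτ.isContraction (Equiv.Set.univ _) (hgrid k')
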